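/- Let $\mathbb T^2=(\mathbb R/2\pi\mathbb Z)^2$ and, for real-valued $f\in L^2(\mathbb T^2)$ and $\xi=(\xi_1,\xi_2)\in\mathbb Z^2$, let $\hat f(\xi)=(2\pi)^{-2}\int_{\mathbb T^2}e^{-i\xi_1x-i\xi_2y}f(x,y)\,dx\,dy$ and $|\xi|=(\xi_1^2+\xi_2^2)^{1/2}$. Let $H^s(\mathbb T^2)$ be the space of real-valued $f\in L^2(\mathbb T^2)$ with $\|f\|_{H^s}^2=\sum_{\xi\in\mathbb Z^2}(1+|\xi|^2)^s|\hat f(\xi)|^2<\infty$, and let $\Lambda$ be the operator given by $\widehat{\Lambda f}(\xi)=|\xi|\hat f(\xi)$. Let $\beta>0$, $\delta\ge 0$ and $\varepsilon>0$ be real constants. For every $\eta_0\in H^2(\mathbb T^2)$ and every $0<T<\infty$, the initial value problem $$\eta_t+\eta\eta_x+(\beta-1)\eta_{xx}-\eta_{yy}-\delta\Lambda^3\eta+\varepsilon\Delta^2\eta=0\quad\text{on }\mathbb T^2\times(0,T),\qquad \eta(\cdot,\cdot,0)=\eta_0,$$ has a unique solution $$\eta\in C([0,T];H^2(\mathbb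 T^2))\cap L^2(0,T;H^4(\mathbb T^2)).$$ Here a solution is a function $\eta$ in this class with $\eta(0)=\eta_0$ that is absolutely continuous in time with values in $L^2(\mathbb T^2)$, that is, $\eta(t)=\eta_0+\int_0^t\eta_t(s)\,ds$ for all $t\in[0,T]$ with some $\eta_t\in L^1(0,T;L^2(\mathbb T^2))$, and for which the equation holds almost everywhere on $\mathbb T^2$ for almost every $t\in(0,T)$. Uniqueness means that any two solutions in this class with the same initial datum $\eta_0$ coincide in $L^2(\mathbb T^2)$ for every $t\in[0,T]$. -/

import Mathlib

open MeasureTheory Set Filter Topology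
open scoped ENNReal

noncomputable section

namespace KSTorus

instance factTwoPiPos : Fact ((0 : ℝ) < 2 * Real.pi) := ⟨Real.two_pi_pos⟩

/-- The torus `𝕋² = (ℝ/2πℤ)²`, with Lebesgue measure `dx dy` (of total mass `(2π)²`). The
coordinate `x` has index `0` and the coordinate `y` has index `1`. -/
abbrev Torus2 : Type := Fin 2 → AddCircle (2 * Real.pi)

/-- The real Hilbert space `L²(𝕋²)` of real-valued functions. -/
abbrev L2 : Type := Lp ℝ 2 (volume : Measure Torus2)

/-- The frequency lattice `ℤ²`. -/
abbrev Freq : Type := Fin 2 → ℤ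

/-- `|ξ| = (ξ₁² + ξ₂²)^{1/2}`. -/
def freqNorm (ξ : Freq) : ℝ := Real.sqrt ((ξ 0 : ℝ) ^ 2 + (ξ 1 : ℝ) ^ 2)

/-- The Fourier coefficient `(2π)⁻² ∫ e^{-i ξ₁ x - i ξ₂ y} f(x, y) dx dy`; Mathlib's
`fourier n` on `ℝ/2πℤ` is `x ↦ e^{i n x}`. -/
def coeff (f : L2) (ξ : Freq) : ℂ :=
  ((2 * Real.pi : ℂ) ^ 2)⁻¹ *
    ∫ p : Torus2, fourier (-ξ 0) (p 0) * fourier (-ξ 1) (p 1) * ((f p : ℝ) : ℂ)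

/-- The Sobolev norm `(∑_ξ (1 + |ξ|²)^s |f̂(ξ)|²)^{1/2}`, with value `∞` outside `H^s(𝕋²)`. -/
def sobolevENorm (s : ℕ) (f : L2) : ℝ≥0∞ :=
  (∑' ξ : Freq, ENNReal.ofReal ((1 + freqNorm ξ ^ 2) ^ s * ‖coeff f ξ‖ ^ 2)) ^ (1 / 2 : ℝ)

/-- `f ∈ H^s(𝕋²)`. -/
def MemSobolev (s : ℕ) (f : L2) : Prop := sobolevENorm s f < ∞

/-- `g ∈ L²(𝕋²)` is the image of `f` under the operator with Fourier symbol `m`. -/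
def HasSymbol (m : Freq → ℂ) (f g : L2) : Prop := ∀ ξ, coeff g ξ = m ξ * coeff f ξ

/-- Symbol of `∂ₓ`. -/
def symDx (ξ : Freq) : ℂ := Complex.I * (ξ 0 : ℂ)

/-- Symbol of `∂_y`. -/
def symDy (ξ : Freq) : ℂ := Complex.I * (ξ 1 : ℂ)

/-- Symbol of `Λ`. -/
def symLambda (ξ : Freq) : ℂ := ((freqNorm ξ : ℝ) : ℂ)

/-- `η ∈ C([0,T]; H^s(𝕋²))`. -/
def ContInSobolev (s : ℕ) (T : ℝ) (η : ℝ → L2) : Prop :=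
  ∀ t ∈ Icc 0 T, MemSobolev s (η t) ∧
    Tendsto (fun r => sobolevENorm s (η r - η t)) (𝓝[Icc 0 T] t) (𝓝 0)

/-- `η ∈ L²(0,T; H^s(𝕋²))`. As `H^s(𝕋²)` is separable and continuously embedded in `L²(𝕋²)`,
strong measurability in `H^s` is strong measurability in `L²` together with `η(t) ∈ H^s` for
almost every `t`. -/
def L2InSobolev (s : ℕ) (T : ℝ) (η : ℝ → L2) : Prop :=
  AEStronglyMeasurable η (volume.restrict (Ioo 0 T)) ∧
    (∀ᵐ t ∂volume.restrict (Ioo 0 T), MemSobolev s (η t)) ∧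
      ∫⁻ t in Ioo 0 T, sobolevENorm s (η t) ^ 2 < ∞

/-- At one instant: `v + u uₓ + (β - 1) uₓₓ - u_yy - δ Λ³u + ε Δ²u = 0` almost everywhere on
`𝕋²`, all the derivatives of `u` that occur (and `Λ³u`) being functions in `L²(𝕋²)`. -/
def SatisfiesPDE (β δ ε : ℝ) (u v : L2) : Prop :=
  ∃ ux uxx uyy lam bilap : L2,
    HasSymbol symDx u ux ∧
    HasSymbol (fun ξ => symDx ξ ^ 2) u uxx ∧
    HasSymbol (fun ξ => symDy ξ ^ 2) u uyy ∧
    HasSymbol (fun ξ => symLambda ξ ^ 3) u lam ∧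
    HasSymbol (fun ξ => (symDx ξ ^ 2 + symDy ξ ^ 2) ^ 2) u bilap ∧
    ∀ᵐ p : Torus2, v p + u p * ux p + (β - 1) * uxx p - uyy p - δ * lam p + ε * bilap p = 0

/-- `η ∈ C([0,T]; H²(𝕋²)) ∩ L²(0,T; H⁴(𝕋²))` is a strong solution on `[0,T]` with initial datum
`η₀`: `η` is absolutely continuous with values in `L²(𝕋²)`, being the integral of its time
derivative `η_t ∈ L¹(0,T; L²(𝕋²))`, and the equation holds almost everywhere. -/
def IsSolution (β δ ε T : ℝ) (η₀ : L2) (η : ℝ → L2) : Prop :=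
  ContInSobolev 2 T η ∧ L2InSobolev 4 T η ∧ η 0 = η₀ ∧
    ∃ ηt : ℝ → L2, IntervalIntegrable ηt volume 0 T ∧
      (∀ t ∈ Icc 0 T, η t = η 0 + ∫ s in (0 : ℝ)..t, ηt s) ∧
      ∀ᵐ t ∂volume.restrict (Ioo 0 T), SatisfiesPDE β δ ε (η t) (ηt t)

end KSTorus

end

/-!
The equation is `η_t = P η - η η_x`, where `P` has the real symbol
`p(ξ) = (β - 1) ξ₁² - ξ₂² + δ |ξ|³ - ε |ξ|⁴ ≤ C - c (1 + |ξ|²)²` (`isParabolic_linSym`). All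
estimates are made on the Fourier coefficients, in which `P` is diagonal; the unknown is the
function `a = (1 - Δ) η` with values in `L²(𝕋²)`, so that `η = bessel a`, and continuity of `η` in
`H²(𝕋²)` is continuity of `a` in `L²(𝕋²)`.

*Existence.* The transport term is locally Lipschitz from `H²` to `L²`
(`norm_transport_sub_le`), and `(1 - Δ) e^{sP}` has norm `O(s^{-1/2})` on `L²`
(`IsParabolic.norm_kernelSym_le`). After truncation of the nonlinearity outside a ball of `H²`, the
mild formulation is thus a Volterra equation with an integrable kernel and a globally Lipschitz
nonlinearity, which is solved on all of `[0, T]` by the contraction principle in a norm with an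
exponential weight (`VolterraKernel.exists_solution`). The truncation amounts to a scalar damping
factor `θ(t)` in front of `η η_x`, and three steps bound `η` in `H²` independently of it
(`exists_bound_of_isDampedMild`). As `∫ η² η_x = 0`, the `L²` norm grows at most exponentially. As
`η η_x = ½ ∂ₓ(η²)` and the Fourier coefficients of `η²` are bounded by `‖η‖²`, Duhamel's formula
gives `|η̂(t, ξ)| ≤ A |η̂₀(ξ)| + B |ξ₁| (1 + |ξ|²)⁻²`, which bounds `η` in `L^∞` and `η_x` in `L²`.
Hence `η η_x` is bounded in `L²`, and the smoothing estimate bounds `η` in `H²`. If the radius of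
the truncation exceeds this bound, then `θ = 1` on `[0, T]`.

*Regularity.* The balance of `|η̂(t, ξ)|²`, multiplied by `(1 + |ξ|²)²` and summed over `ξ`, shows
that `η` is in `L²(0, T; H⁴)` (`IsDampedMild.lintegral_sobolevENorm_lt_top`), so that `P η` is a
function in `L²(𝕋²)` for almost every `t` and the integrated equations for the coefficients combine
into the strong form (`isSolution_of_isDampedMild`).

*Uniqueness.* The Fourier coefficients of any strong solution satisfy an integrated equation with a
continuous integrand, because `η(t)` is continuous in `H²`. For the difference `w` of two solutions,
the transport terms differ by `½ ∂ₓ((η + η') w)`, whose derivative is absorbed by the dissipation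
mode by mode; Grönwall's inequality for `‖w‖²` gives `w = 0` (`IsSolution.unique`).
-/

noncomputable section

namespace KSTorus

open scoped ComplexConjugate

/-! ### Fourier series on the torus -/

/-- The character `(x, y) ↦ e^{i ξ₁ x + i ξ₂ y}`. -/
def char (ξ : Freq) : C(Torus2, ℂ) where
  toFun p := fourier (ξ 0) (p 0) * fourier (ξ 1) (p 1)
  continuous_toFun := by fun_prop

lemma char_apply (ξ : Freq) (p : Torus2) :
    char ξ p = fourier (ξ 0) (p 0) * fourier (ξ 1) (p 1) := rfl

lemma char_neg (ξ : Freq) (p : Torus2) : char (-ξ) p = conj (char ξ p) := by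
  simp only [char_apply, Pi.neg_apply, fourier_neg, map_mul]

lemma char_add (ξ η : Freq) (p : Torus2) : char (ξ + η) p = char ξ p * char η p := by
  simp only [char_apply, Pi.add_apply, fourier_add]; ring

lemma char_zero (p : Torus2) : char 0 p = 1 := by
  simp [char_apply]

lemma norm_char (ξ : Freq) (p : Torus2) : ‖char ξ p‖ = 1 := by
  simp [char_apply, fourier_apply, Circle.norm_coe]

lemma norm_char_le (ξ : Freq) : ‖char ξ‖ ≤ 1 :=
  (ContinuousMap.norm_le _ zero_le_one).mpr fun p => (norm_char ξ p).le

lemma span_char_closure_eq_top :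
    (Submodule.span ℂ (range char)).topologicalClosure = ⊤ := by
  let A : StarSubalgebra ℂ C(Torus2, ℂ) :=
    { toSubalgebra := Algebra.adjoin ℂ (range char)
      star_mem' := by
        change Algebra.adjoin ℂ (range char) ≤ star (Algebra.adjoin ℂ (range char))
        refine Algebra.adjoin_le ?_
        rintro _ ⟨n, rfl⟩
        refine Algebra.subset_adjoin ⟨-n, ?_⟩
        ext1 x
        simp only [char_neg, starRingEnd_apply, ContinuousMap.star_apply] }
  have hA : Subalgebra.toSubmodule A.toSubalgebra = Submodule.span ℂ (range char) := by
    apply Algebra.adjoin_eq_span_of_subset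
    refine .trans (fun x ↦ Submonoid.closure_induction (fun _ ↦ id) ⟨0, ?_⟩ ?_)
      Submodule.subset_span
    · ext z
      simp [char_zero]
    · rintro _ _ _ _ ⟨m, rfl⟩ ⟨n, rfl⟩
      refine ⟨m + n, ?_⟩
      ext z
      simp [char_add]
  have hsep : A.SeparatesPoints := by
    intro x y hxy
    rw [Ne, funext_iff, not_forall] at hxy
    obtain ⟨i, hi⟩ := hxy
    refine ⟨_, ⟨char (Pi.single i 1), Algebra.subset_adjoin ⟨Pi.single i 1, rfl⟩, rfl⟩, ?_⟩
    have key : ∀ z : Torus2, char (Pi.single i 1) z = fourier 1 (z i) := by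
      intro z
      fin_cases i <;> simp [char_apply]
    dsimp only
    rw [key, key, fourier_one, fourier_one]
    exact fun h => hi (AddCircle.injective_toCircle Real.two_pi_pos.ne' (Circle.coe_injective h))
  rw [← hA]
  exact congr_arg (Subalgebra.toSubmodule <| StarSubalgebra.toSubalgebra ·)
    (ContinuousMap.starSubalgebra_topologicalClosure_eq_top_of_separatesPoints A hsep)

/-- The complex Hilbert space `L²(𝕋²; ℂ)`. -/
abbrev L2C : Type := Lp ℂ 2 (volume : Measure Torus2)

lemma integral_fourier (n : ℤ) :
    ∫ x : AddCircle (2 * Real.pi), fourier n x = if n = 0 then 2 * (Real.pi : ℂ) else 0 := by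
  split_ifs with h
  · subst h
    simp only [fourier_zero, integral_const, Measure.real, AddCircle.measure_univ]
    rw [ENNReal.toReal_ofReal Real.two_pi_pos.le]
    simp
  · have := integral_eq_zero_of_add_right_eq_neg (μ := (volume : Measure (AddCircle (2 * Real.pi))))
      (fourier_add_half_inv_index (T := 2 * Real.pi) h Real.two_pi_pos)
    exact this

lemma integral_char (ξ : Freq) :
    ∫ p : Torus2, char ξ p = if ξ = 0 then (2 * (Real.pi : ℂ)) ^ 2 else 0 := by
  have h : ∀ p : Torus2, char ξ p = ∏ i, (fun j => fourier (ξ j)) i (p i) := by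
    intro p; simp [char_apply, Fin.prod_univ_two]
  simp_rw [h]
  rw [MeasureTheory.integral_fintype_prod_volume_eq_prod]
  simp only [integral_fourier, Fin.prod_univ_two]
  by_cases h0 : ξ 0 = 0 <;> by_cases h1 : ξ 1 = 0
  · have : ξ = 0 := by ext i; fin_cases i <;> simp [h0, h1]
    simp [this, sq]
  all_goals
    have : ξ ≠ 0 := by rintro rfl; simp_all
    simp [h0, h1, this]

/-- The normalised character `e_ξ / 2π` as an element of `L²(𝕋²; ℂ)`. -/
def charLp (ξ : Freq) : L2C :=
  ContinuousMap.toLp (E := ℂ) 2 volume ℂ ((2 * (Real.pi : ℂ))⁻¹ • char ξ)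

lemma coeFn_charLp (ξ : Freq) :
    charLp ξ =ᵐ[volume] fun p => (2 * (Real.pi : ℂ))⁻¹ * char ξ p :=
  ContinuousMap.coeFn_toLp volume _

lemma orthonormal_charLp : Orthonormal ℂ charLp := by
  rw [orthonormal_iff_ite]
  intro m n
  simp only [charLp, ContinuousMap.inner_toLp]
  have h : ∀ p : Torus2, ((2 * (Real.pi : ℂ))⁻¹ • char n) p *
      conj (((2 * (Real.pi : ℂ))⁻¹ • char m) p) =
      ((2 * (Real.pi : ℂ))⁻¹) ^ 2 * char (n - m) p := by
    intro p
    simp only [ContinuousMap.smul_apply, smul_eq_mul, map_mul, map_inv₀, Complex.conj_ofReal,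
      sub_eq_add_neg, char_add, char_neg, map_ofNat]
    ring
  simp_rw [h]
  rw [integral_const_mul, integral_char]
  have hpi : (Real.pi : ℂ) ≠ 0 := by exact_mod_cast Real.pi_ne_zero
  by_cases hmn : m = n
  · simp [hmn]; field_simp
  · have : n - m ≠ 0 := sub_ne_zero.mpr (Ne.symm hmn)
    simp [hmn, this]

lemma span_charLp_closure_eq_top :
    (Submodule.span ℂ (range charLp)).topologicalClosure = ⊤ := by
  have h1 : Submodule.span ℂ (range fun ξ => (2 * (Real.pi : ℂ))⁻¹ • char ξ) =
      Submodule.span ℂ (range char) := by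
    have hc : IsUnit ((2 * (Real.pi : ℂ))⁻¹) := by
      exact (by simp : (2 * (Real.pi : ℂ))⁻¹ ≠ 0).isUnit
    rw [← Submodule.span_smul_eq_of_isUnit (range char) _ hc]
    congr 1
    ext x; simp [Set.mem_smul_set]
  have h2 := (ContinuousMap.toLp_denseRange (p := 2) ℂ (volume : Measure Torus2) ℂ
    (by simp)).topologicalClosure_map_submodule (h1 ▸ span_char_closure_eq_top)
  rw [Submodule.map_span, ← range_comp] at h2
  exact h2

/-- The Hilbert basis of `L²(𝕋²; ℂ)` consisting of the normalised characters. -/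
def charBasis : HilbertBasis Freq ℂ L2C :=
  HilbertBasis.mk orthonormal_charLp span_charLp_closure_eq_top.ge

@[simp] lemma coe_charBasis : ⇑charBasis = charLp := HilbertBasis.coe_mk _ _

/-! ### Fourier coefficients of real functions -/

/-- The Fourier coefficients of a real function on the torus that need not be square
integrable. -/
def funCoeff (F : Torus2 → ℝ) (ξ : Freq) : ℂ :=
  ((2 * Real.pi : ℂ) ^ 2)⁻¹ * ∫ p : Torus2, char (-ξ) p * ((F p : ℝ) : ℂ)

lemma coeff_eq_funCoeff (f : L2) (ξ : Freq) : coeff f ξ = funCoeff f ξ := rfl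

lemma funCoeff_congr {F G : Torus2 → ℝ} (h : F =ᵐ[volume] G) (ξ : Freq) :
    funCoeff F ξ = funCoeff G ξ := by
  unfold funCoeff
  congr 1
  refine integral_congr_ae ?_
  filter_upwards [h] with p hp
  rw [hp]

/-- A real square integrable function, seen as a complex one. -/
def toC : L2 →L[ℝ] L2C := Complex.ofRealCLM.compLpL 2 volume

/-- The real part of a complex square integrable function. -/
def reL : L2C →L[ℝ] L2 := Complex.reCLM.compLpL 2 volume

lemma coeFn_toC (f : L2) : toC f =ᵐ[volume] fun p => ((f p : ℝ) : ℂ) :=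
  Complex.ofRealCLM.coeFn_compLpL f

lemma coeFn_reL (f : L2C) : reL f =ᵐ[volume] fun p => (f p).re :=
  Complex.reCLM.coeFn_compLpL f

lemma inner_toC (f g : L2) : inner ℂ (toC f) (toC g) = ((inner ℝ f g : ℝ) : ℂ) := by
  rw [L2.inner_def, L2.inner_def]
  refine Eq.trans (integral_congr_ae ?_) integral_complex_ofReal
  filter_upwards [coeFn_toC f, coeFn_toC g] with p h1 h2
  rw [h1, h2]
  simp

lemma inner_charLp (F : L2C) (ξ : Freq) :
    inner ℂ (charLp ξ) F = (2 * (Real.pi : ℂ))⁻¹ * ∫ p : Torus2, char (-ξ) p * F p := by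
  rw [L2.inner_def, ← integral_const_mul]
  refine integral_congr_ae ?_
  filter_upwards [coeFn_charLp ξ] with p h
  rw [h]
  simp only [RCLike.inner_apply, map_mul, map_inv₀, Complex.conj_ofReal, char_neg, map_ofNat]
  ring

lemma inner_charLp_toC (f : L2) (ξ : Freq) :
    inner ℂ (charLp ξ) (toC f) = (2 * (Real.pi : ℂ)) * coeff f ξ := by
  rw [inner_charLp, coeff_eq_funCoeff, funCoeff]
  have : ∫ p : Torus2, char (-ξ) p * toC f p = ∫ p : Torus2, char (-ξ) p * ((f p : ℝ) : ℂ) := by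
    refine integral_congr_ae ?_
    filter_upwards [coeFn_toC f] with p h
    rw [h]
  rw [this]
  have hpi : (Real.pi : ℂ) ≠ 0 := by exact_mod_cast Real.pi_ne_zero
  field_simp

/-- The `ξ`-th Fourier coefficient as a continuous linear functional on `L²(𝕋²)`. -/
def coeffL (ξ : Freq) : L2 →L[ℝ] ℂ :=
  ((2 * (Real.pi : ℂ))⁻¹ • (innerSL ℂ (charLp ξ))).restrictScalars ℝ ∘L toC

lemma coeffL_apply (f : L2) (ξ : Freq) : coeffL ξ f = coeff f ξ := by
  have hpi : (Real.pi : ℂ) ≠ 0 := by exact_mod_cast Real.pi_ne_zero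
  simp only [coeffL, ContinuousLinearMap.comp_apply, ContinuousLinearMap.coe_restrictScalars',
    _root_.smul_apply, innerSL_apply_apply, inner_charLp_toC, smul_eq_mul]
  field_simp

lemma coeff_add (f g : L2) (ξ : Freq) : coeff (f + g) ξ = coeff f ξ + coeff g ξ := by
  simp only [← coeffL_apply, map_add]

lemma coeff_sub (f g : L2) (ξ : Freq) : coeff (f - g) ξ = coeff f ξ - coeff g ξ := by
  simp only [← coeffL_apply, map_sub]

lemma coeff_neg (f : L2) (ξ : Freq) : coeff (-f) ξ = -coeff f ξ := by
  simp only [← coeffL_apply, map_neg]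

lemma coeff_smul (c : ℝ) (f : L2) (ξ : Freq) : coeff (c • f) ξ = c * coeff f ξ := by
  simp only [← coeffL_apply, map_smul, Complex.real_smul]

lemma coeff_zero (ξ : Freq) : coeff 0 ξ = 0 := by
  simp only [← coeffL_apply, map_zero]

lemma continuous_coeff (ξ : Freq) : Continuous fun f : L2 => coeff f ξ := by
  simp only [← coeffL_apply]; exact (coeffL ξ).continuous

/-- **Parseval's identity**. -/
lemma hasSum_conj_coeff_mul (f g : L2) :
    HasSum (fun ξ => conj (coeff f ξ) * coeff g ξ)
      (((2 * Real.pi) ^ 2)⁻¹ * inner ℝ f g : ℝ) := by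
  have h := (charBasis.hasSum_inner_mul_inner (toC f) (toC g)).mul_left
    (((2 * (Real.pi : ℂ)) ^ 2)⁻¹)
  rw [inner_toC] at h
  have hpi : (Real.pi : ℂ) ≠ 0 := by exact_mod_cast Real.pi_ne_zero
  have e1 : (fun ξ => conj (coeff f ξ) * coeff g ξ) = fun ξ => ((2 * (Real.pi : ℂ)) ^ 2)⁻¹ *
      (inner ℂ (toC f) (charBasis ξ) * inner ℂ (charBasis ξ) (toC g)) := by
    ext1 ξ
    rw [coe_charBasis, inner_charLp_toC, ← inner_conj_symm, inner_charLp_toC]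
    simp only [map_mul, Complex.conj_ofReal, Complex.conj_ofNat]
    field_simp
  rw [e1]
  push_cast
  exact h

lemma hasSum_sq_norm_coeff (f : L2) :
    HasSum (fun ξ => ‖coeff f ξ‖ ^ 2) (((2 * Real.pi) ^ 2)⁻¹ * ‖f‖ ^ 2) := by
  have h := hasSum_conj_coeff_mul f f
  rw [real_inner_self_eq_norm_sq] at h
  have h2 := Complex.hasSum_re h
  simp only [Complex.ofReal_re] at h2
  convert h2 using 1
  ext ξ
  rw [Complex.conj_mul']
  norm_cast

lemma hasSum_re_inner_coeff (f g : L2) :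
    HasSum (fun ξ => inner ℝ (coeff f ξ) (coeff g ξ)) (((2 * Real.pi) ^ 2)⁻¹ * inner ℝ f g) := by
  have h2 := Complex.hasSum_re (hasSum_conj_coeff_mul f g)
  rw [Complex.ofReal_re] at h2
  convert h2 using 1
  ext ξ
  simp [Complex.inner, mul_comm]

lemma summable_sq_norm_coeff (f : L2) : Summable fun ξ => ‖coeff f ξ‖ ^ 2 :=
  (hasSum_sq_norm_coeff f).summable

lemma tsum_sq_norm_coeff (f : L2) :
    ∑' ξ, ‖coeff f ξ‖ ^ 2 = ((2 * Real.pi) ^ 2)⁻¹ * ‖f‖ ^ 2 :=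
  (hasSum_sq_norm_coeff f).tsum_eq

lemma norm_sq_eq_tsum (f : L2) : ‖f‖ ^ 2 = (2 * Real.pi) ^ 2 * ∑' ξ, ‖coeff f ξ‖ ^ 2 := by
  rw [tsum_sq_norm_coeff]
  have hpi := Real.pi_ne_zero
  field_simp

/-- A function in `L²(𝕋²)` is determined by its Fourier coefficients. -/
lemma ext_coeff {f g : L2} (h : ∀ ξ, coeff f ξ = coeff g ξ) : f = g := by
  have h1 : ‖f - g‖ ^ 2 = 0 := by
    rw [norm_sq_eq_tsum]
    simp [coeff_sub, h]
  rw [← sub_eq_zero, ← norm_eq_zero]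
  simpa using h1

lemma inv_two_pi_sq_le_one : ((2 * Real.pi) ^ 2)⁻¹ ≤ 1 := by
  refine inv_le_one_of_one_le₀ (one_le_pow₀ ?_)
  linarith [Real.pi_gt_three]

lemma tsum_sq_norm_coeff_le (f : L2) : ∑' ξ, ‖coeff f ξ‖ ^ 2 ≤ ‖f‖ ^ 2 := by
  rw [tsum_sq_norm_coeff]
  exact mul_le_of_le_one_left (sq_nonneg _) inv_two_pi_sq_le_one

lemma sum_sq_norm_coeff_le (f : L2) (F : Finset Freq) : ∑ ξ ∈ F, ‖coeff f ξ‖ ^ 2 ≤ ‖f‖ ^ 2 :=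
  ((summable_sq_norm_coeff f).sum_le_tsum F fun _ _ => sq_nonneg _).trans
    (tsum_sq_norm_coeff_le f)

lemma conj_funCoeff (F : Torus2 → ℝ) (ξ : Freq) : conj (funCoeff F ξ) = funCoeff F (-ξ) := by
  unfold funCoeff
  rw [map_mul, ← integral_conj]
  congr 1
  · simp [Complex.conj_ofNat]
  · congr 1 with p
    simp [char_neg]

/-- The symmetry that characterises the Fourier coefficients of real functions and the symbols of
the operators preserving real functions. -/
def ConjSymm (c : Freq → ℂ) : Prop := ∀ ξ, c (-ξ) = conj (c ξ)

lemma conjSymm_coeff (f : L2) : ConjSymm (coeff f) := fun ξ => (conj_funCoeff f ξ).symm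

/-- **Riesz–Fischer** for real functions: a square summable family with the symmetry of the
Fourier coefficients of a real function is the family of Fourier coefficients of one. -/
lemma exists_coeff_eq {c : Freq → ℂ} (hc : ConjSymm c) (hs : Summable fun ξ => ‖c ξ‖ ^ 2) :
    ∃ f : L2, ∀ ξ, coeff f ξ = c ξ := by
  have hpi : (Real.pi : ℂ) ≠ 0 := by exact_mod_cast Real.pi_ne_zero
  have hmem : Memℓp (fun ξ => (2 * (Real.pi : ℂ)) * c ξ) 2 := by
    refine memℓp_gen ?_
    simp only [norm_mul, ENNReal.toReal_ofNat, Real.rpow_two, mul_pow]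
    exact hs.mul_left _
  set F : L2C := charBasis.repr.symm ⟨_, hmem⟩ with hF
  have hin : ∀ ξ, inner ℂ (charLp ξ) F = (2 * (Real.pi : ℂ)) * c ξ := by
    intro ξ
    rw [← coe_charBasis, ← charBasis.repr_apply_apply, hF, LinearIsometryEquiv.apply_symm_apply]
  have hint : ∀ ξ, ∫ p : Torus2, char (-ξ) p * F p = (2 * (Real.pi : ℂ)) ^ 2 * c ξ := by
    intro ξ
    have h := hin ξ
    rw [inner_charLp] at h
    field_simp at h ⊢
    rw [h]
  have hFint : Integrable F volume := (Lp.memLp F).integrable (by norm_num)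
  have hi : ∀ ξ, Integrable (fun p => char ξ p * F p) volume := fun ξ =>
    hFint.bdd_mul (char ξ).continuous.aestronglyMeasurable
      (Eventually.of_forall fun p => (norm_char ξ p).le)
  refine ⟨reL F, fun ξ => ?_⟩
  rw [coeff_eq_funCoeff, funCoeff_congr (coeFn_reL F), funCoeff]
  -- the real part of `F` is the mean of `F` and its conjugate
  have h1 : ∀ p, char (-ξ) p * (((F p).re : ℝ) : ℂ) =
      (char (-ξ) p * F p + conj (char ξ p * F p)) / 2 := by
    intro p
    rw [Complex.re_eq_add_conj, map_mul, ← char_neg]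
    ring
  have h2 : ∫ p, conj (char ξ p * F p) = (2 * (Real.pi : ℂ)) ^ 2 * c ξ := by
    rw [integral_conj]
    have := hint (-ξ)
    rw [neg_neg] at this
    rw [this, hc]
    simp [Complex.conj_ofNat]
  simp_rw [h1]
  rw [integral_div, integral_add (hi _) (by
    have := (hi ξ).norm
    refine (integrable_norm_iff ?_).1 (by simpa using this)
    exact (continuous_star.comp_aestronglyMeasurable (hi ξ).1)), hint, h2]
  field_simp
  ring

/-- The Fourier coefficients of a product of two functions in `L²(𝕋²)` are the convolution of the
Fourier coefficients. -/
lemma hasSum_funCoeff_mul (f g : L2) (ξ : Freq) :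
    HasSum (fun η => coeff f (ξ - η) * coeff g η) (funCoeff (fun p => f p * g p) ξ) := by
  have hmem : MemLp (fun p => char ξ p * ((f p : ℝ) : ℂ)) 2 (volume : Measure Torus2) := by
    have h1 : MemLp (toC f) 2 volume := Lp.memLp _
    refine (h1.norm.of_le (f := fun p => char ξ p * ((f p : ℝ) : ℂ)) ?_ ?_)
    · exact (char ξ).continuous.aestronglyMeasurable.mul
        (Complex.continuous_ofReal.comp_aestronglyMeasurable (Lp.aestronglyMeasurable f))
    · filter_upwards [coeFn_toC f] with p hp
      simp [hp, norm_char]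
  have hpi : (Real.pi : ℂ) ≠ 0 := by exact_mod_cast Real.pi_ne_zero
  have h := (charBasis.hasSum_inner_mul_inner (hmem.toLp _) (toC g)).mul_left
    (((2 * (Real.pi : ℂ)) ^ 2)⁻¹)
  have e1 : (fun η => coeff f (ξ - η) * coeff g η) = fun η => ((2 * (Real.pi : ℂ)) ^ 2)⁻¹ *
      (inner ℂ (hmem.toLp _) (charBasis η) * inner ℂ (charBasis η) (toC g)) := by
    ext1 η
    rw [coe_charBasis, inner_charLp_toC, ← inner_conj_symm, inner_charLp]
    have h1 : ∫ p : Torus2, char (-η) p * (hmem.toLp _) p =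
        ∫ p : Torus2, char (-(η - ξ)) p * ((f p : ℝ) : ℂ) := by
      refine integral_congr_ae ?_
      filter_upwards [hmem.coeFn_toLp] with p hp
      rw [hp, neg_sub, sub_eq_add_neg, char_add]
      ring
    have h2 : coeff f (ξ - η) = conj (coeff f (η - ξ)) := by
      rw [← conjSymm_coeff f, neg_sub]
    rw [h1, h2, coeff_eq_funCoeff, funCoeff]
    simp only [map_mul, map_inv₀, Complex.conj_ofReal, Complex.conj_ofNat, map_pow]
    field_simp
  have e2 : funCoeff (fun p => f p * g p) ξ =
      ((2 * (Real.pi : ℂ)) ^ 2)⁻¹ * inner ℂ (hmem.toLp _) (toC g) := by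
    unfold funCoeff
    rw [L2.inner_def]
    congr 1
    refine integral_congr_ae ?_
    filter_upwards [hmem.coeFn_toLp, coeFn_toC g] with p h1 h2
    rw [h1, h2, char_neg]
    simp only [RCLike.inner_apply, map_mul, Complex.conj_ofReal]
    push_cast; ring
  rw [e1, e2]
  exact h

/-- A function with summable Fourier coefficients is bounded by their sum. -/
lemma ae_norm_le_tsum_norm_coeff {f : L2} (h : Summable fun ξ => ‖coeff f ξ‖) :
    ∀ᵐ p, ‖f p‖ ≤ ∑' ξ, ‖coeff f ξ‖ := by
  have hpi : (Real.pi : ℂ) ≠ 0 := by exact_mod_cast Real.pi_ne_zero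
  have hle : ∀ ξ, ‖coeff f ξ • char ξ‖ ≤ ‖coeff f ξ‖ := fun ξ => by
    rw [norm_smul]; exact mul_le_of_le_one_right (norm_nonneg _) (norm_char_le ξ)
  have hs : Summable fun ξ => coeff f ξ • char ξ := .of_norm (h.of_nonneg_of_le
    (fun _ => norm_nonneg _) hle)
  set G : C(Torus2, ℂ) := ∑' ξ, coeff f ξ • char ξ with hG
  have h1 : HasSum (fun ξ => ContinuousMap.toLp (E := ℂ) 2 volume ℂ (coeff f ξ • char ξ))
      (ContinuousMap.toLp (E := ℂ) 2 volume ℂ G) :=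
    hs.hasSum.mapL (ContinuousMap.toLp (E := ℂ) 2 (volume : Measure Torus2) ℂ)
  have h2 : HasSum (fun ξ => ContinuousMap.toLp (E := ℂ) 2 volume ℂ (coeff f ξ • char ξ))
      (toC f) := by
    convert charBasis.hasSum_repr (toC f) using 1
    ext1 ξ
    rw [charBasis.repr_apply_apply, coe_charBasis, inner_charLp_toC, charLp, ← map_smul]
    congr 1
    rw [smul_smul]
    congr 1
    field_simp
  have h3 : toC f = ContinuousMap.toLp (E := ℂ) 2 volume ℂ G := h2.unique h1
  have h4 : ‖G‖ ≤ ∑' ξ, ‖coeff f ξ‖ := tsum_of_norm_bounded h.hasSum hle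
  filter_upwards [coeFn_toC f, ContinuousMap.coeFn_toLp (p := 2) (𝕜 := ℂ) volume G] with p hp1 hp2
  have : ‖f p‖ = ‖G p‖ := by
    rw [← hp2, ← h3, hp1, Complex.norm_real]
  rw [this]
  exact (G.norm_coe_le_norm p).trans h4

/-! ### Fourier multipliers -/

lemma norm_le_of_norm_coeff_le {f g : L2} {C : ℝ} (hC : 0 ≤ C)
    (h : ∀ ξ, ‖coeff g ξ‖ ≤ C * ‖coeff f ξ‖) : ‖g‖ ≤ C * ‖f‖ := by
  suffices key : ‖g‖ ^ 2 ≤ (C * ‖f‖) ^ 2 from abs_le_of_sq_le_sq' key (by positivity) |>.2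
  rw [mul_pow, norm_sq_eq_tsum, norm_sq_eq_tsum f, mul_left_comm,
    ← tsum_mul_left (a := C ^ 2)]
  refine mul_le_mul_of_nonneg_left ?_ (sq_nonneg (2 * Real.pi))
  refine (summable_sq_norm_coeff g).tsum_le_tsum (fun ξ => ?_)
    ((summable_sq_norm_coeff f).mul_left _)
  rw [← mul_pow]
  exact pow_le_pow_left₀ (norm_nonneg _) (h ξ) 2

lemma ConjSymm.mul {c d : Freq → ℂ} (hc : ConjSymm c) (hd : ConjSymm d) :
    ConjSymm fun ξ => c ξ * d ξ := fun ξ => by simp only [map_mul, hc ξ, hd ξ]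

lemma HasSymbol.eq {m : Freq → ℂ} {f g h : L2} (hg : HasSymbol m f g) (hh : HasSymbol m f h) :
    g = h := ext_coeff fun ξ => by rw [hg ξ, hh ξ]

/-- The image of `f` under the Fourier multiplier with symbol `m`; it is `0` if that image is not
a real function in `L²(𝕋²)`. -/
def mult (m : Freq → ℂ) (f : L2) : L2 :=
  open Classical in if h : ∃ g, HasSymbol m f g then h.choose else 0

lemma hasSymbol_mult_of_exists {m : Freq → ℂ} {f g : L2} (h : HasSymbol m f g) :
    HasSymbol m f (mult m f) := by
  have h' : ∃ g, HasSymbol m f g := ⟨g, h⟩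
  rw [mult, dif_pos h']
  exact h'.choose_spec

lemma hasSymbol_mult {m : Freq → ℂ} (hm : ConjSymm m) {f : L2}
    (hs : Summable fun ξ => ‖m ξ * coeff f ξ‖ ^ 2) : HasSymbol m f (mult m f) :=
  (exists_coeff_eq (hm.mul (conjSymm_coeff f)) hs).elim fun _ hg => hasSymbol_mult_of_exists hg

lemma coeff_mult {m : Freq → ℂ} (hm : ConjSymm m) {C : ℝ} (hb : ∀ ξ, ‖m ξ‖ ≤ C) (f : L2)
    (ξ : Freq) : coeff (mult m f) ξ = m ξ * coeff f ξ := by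
  refine hasSymbol_mult hm ?_ ξ
  refine ((summable_sq_norm_coeff f).mul_left (C ^ 2)).of_nonneg_of_le (fun _ => by positivity)
    fun ξ => ?_
  rw [norm_mul, mul_pow]
  gcongr
  exact hb ξ

lemma norm_mult_le {m : Freq → ℂ} (hm : ConjSymm m) {C : ℝ} (hb : ∀ ξ, ‖m ξ‖ ≤ C) (f : L2) :
    ‖mult m f‖ ≤ C * ‖f‖ := by
  refine norm_le_of_norm_coeff_le ((norm_nonneg _).trans (hb 0)) fun ξ => ?_
  rw [coeff_mult hm hb, norm_mul]
  gcongr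
  exact hb ξ

lemma mult_sub {m : Freq → ℂ} (hm : ConjSymm m) {C : ℝ} (hb : ∀ ξ, ‖m ξ‖ ≤ C) (f g : L2) :
    mult m (f - g) = mult m f - mult m g :=
  ext_coeff fun ξ => by simp only [coeff_sub, coeff_mult hm hb, mul_sub]

lemma mult_smul {m : Freq → ℂ} (hm : ConjSymm m) {C : ℝ} (hb : ∀ ξ, ‖m ξ‖ ≤ C) (c : ℝ) (f : L2) :
    mult m (c • f) = c • mult m f :=
  ext_coeff fun ξ => by simp only [coeff_smul, coeff_mult hm hb]; ring

/-- Uniformly bounded symbols that converge pointwise give strongly convergent multipliers. -/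
lemma tendsto_mult {ι : Type*} {l : Filter ι} {m : ι → Freq → ℂ} {m₀ : Freq → ℂ} {C : ℝ}
    (hm : ∀ i, ConjSymm (m i)) (hm₀ : ConjSymm m₀) (hb : ∀ᶠ i in l, ∀ ξ, ‖m i ξ‖ ≤ C)
    (hb₀ : ∀ ξ, ‖m₀ ξ‖ ≤ C) (hlim : ∀ ξ, Tendsto (fun i => m i ξ) l (𝓝 (m₀ ξ)))
    {f : ι → L2} {f₀ : L2} (hf : Tendsto f l (𝓝 f₀)) :
    Tendsto (fun i => mult (m i) (f i)) l (𝓝 (mult m₀ f₀)) := by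
  have h1 : Tendsto (fun i => ‖mult (m i) f₀ - mult m₀ f₀‖ ^ 2) l (𝓝 0) := by
    simp_rw [norm_sq_eq_tsum]
    rw [show (0 : ℝ) = (2 * Real.pi) ^ 2 * ∑' _ : Freq, (0 : ℝ) by simp]
    refine Tendsto.const_mul _ ?_
    refine tendsto_tsum_of_dominated_convergence
      ((summable_sq_norm_coeff f₀).mul_left ((C + C) ^ 2)) (fun ξ => ?_) ?_
    · have h2 : Tendsto (fun i => ‖(m i ξ - m₀ ξ) * coeff f₀ ξ‖ ^ 2) l (𝓝 0) := by
        have := (((hlim ξ).sub_const (m₀ ξ)).mul_const (coeff f₀ ξ)).norm.pow 2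
        simpa using this
      refine h2.congr' ?_
      filter_upwards [hb] with i hi
      rw [coeff_sub, coeff_mult (hm i) hi, coeff_mult hm₀ hb₀, sub_mul]
    · filter_upwards [hb] with i hi ξ
      rw [coeff_sub, coeff_mult (hm i) hi, coeff_mult hm₀ hb₀, ← sub_mul, Real.norm_of_nonneg
        (by positivity), norm_mul, mul_pow]
      gcongr
      exact (norm_sub_le _ _).trans (add_le_add (hi ξ) (hb₀ ξ))
  have h2 : Tendsto (fun i => ‖mult (m i) f₀ - mult m₀ f₀‖) l (𝓝 0) := by
    have := h1.sqrt
    simpa [Real.sqrt_sq] using this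
  have h3 : Tendsto (fun i => C * ‖f i - f₀‖ + ‖mult (m i) f₀ - mult m₀ f₀‖) l (𝓝 0) := by
    have := ((hf.sub_const f₀).norm.const_mul C).add h2
    simpa using this
  rw [tendsto_iff_norm_sub_tendsto_zero]
  refine squeeze_zero' (Eventually.of_forall fun _ => norm_nonneg _) ?_ h3
  filter_upwards [hb] with i hi
  calc ‖mult (m i) (f i) - mult m₀ f₀‖
      = ‖mult (m i) (f i - f₀) + (mult (m i) f₀ - mult m₀ f₀)‖ := by
        rw [mult_sub (hm i) hi]; congr 1; abel
    _ ≤ _ := (norm_add_le _ _).trans (by gcongr; exact norm_mult_le (hm i) hi _)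

/-! ### Sobolev spaces -/

/-- The weight `1 + |ξ|²`. -/
def weight (ξ : Freq) : ℝ := 1 + freqNorm ξ ^ 2

lemma freqNorm_sq (ξ : Freq) : freqNorm ξ ^ 2 = (ξ 0 : ℝ) ^ 2 + (ξ 1 : ℝ) ^ 2 :=
  Real.sq_sqrt (by positivity)

lemma freqNorm_nonneg (ξ : Freq) : 0 ≤ freqNorm ξ := Real.sqrt_nonneg _

lemma freqNorm_neg (ξ : Freq) : freqNorm (-ξ) = freqNorm ξ := by simp [freqNorm]

lemma one_le_weight (ξ : Freq) : 1 ≤ weight ξ := by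
  have := sq_nonneg (freqNorm ξ); unfold weight; linarith

lemma weight_pos (ξ : Freq) : 0 < weight ξ := zero_lt_one.trans_le (one_le_weight ξ)

lemma weight_neg (ξ : Freq) : weight (-ξ) = weight ξ := by simp [weight, freqNorm_neg]

lemma sq_le_weight (ξ : Freq) : (ξ 0 : ℝ) ^ 2 ≤ weight ξ := by
  rw [weight, freqNorm_sq]; nlinarith [sq_nonneg (ξ 1 : ℝ)]

lemma norm_symDx (ξ : Freq) : ‖symDx ξ‖ = |(ξ 0 : ℝ)| := by
  simp [symDx]

lemma abs_le_weight (ξ : Freq) : |(ξ 0 : ℝ)| ≤ weight ξ := by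
  nlinarith [sq_le_weight ξ, one_le_weight ξ, sq_abs (ξ 0 : ℝ), abs_nonneg (ξ 0 : ℝ)]

lemma conjSymm_ofReal {m : Freq → ℝ} (h : ∀ ξ, m (-ξ) = m ξ) :
    ConjSymm fun ξ => ((m ξ : ℝ) : ℂ) := fun ξ => by simp [h]

lemma conjSymm_symDx : ConjSymm symDx := fun ξ => by simp [symDx]

lemma sobolevENorm_sq (s : ℕ) (f : L2) : sobolevENorm s f ^ 2 =
    ∑' ξ, ENNReal.ofReal (weight ξ ^ s * ‖coeff f ξ‖ ^ 2) := by
  rw [sobolevENorm, ← ENNReal.rpow_natCast, ← ENNReal.rpow_mul]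
  norm_num [weight]

lemma memSobolev_iff {s : ℕ} {f : L2} :
    MemSobolev s f ↔ Summable fun ξ => weight ξ ^ s * ‖coeff f ξ‖ ^ 2 := by
  have h0 : ∀ ξ, 0 ≤ weight ξ ^ s * ‖coeff f ξ‖ ^ 2 := fun ξ => by
    have := weight_pos ξ; positivity
  have h1 : sobolevENorm s f < ∞ ↔ sobolevENorm s f ^ 2 < ∞ := by
    simp [ENNReal.pow_lt_top_iff]
  rw [MemSobolev, h1, sobolevENorm_sq]
  constructor
  · intro h
    have h1 := ENNReal.summable_toReal h.ne
    simpa only [ENNReal.toReal_ofReal (h0 _)] using h1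
  · intro h
    rw [← ENNReal.ofReal_tsum_of_nonneg h0 h]
    exact ENNReal.ofReal_lt_top

/-- The symbol of the Bessel potential `(1 - Δ)⁻¹`, real and at most `1`. -/
def besselSym (ξ : Freq) : ℂ := ((weight ξ)⁻¹ : ℝ)

/-- The symbol of `∂ₓ (1 - Δ)⁻¹`. -/
def dxBesselSym (ξ : Freq) : ℂ := symDx ξ * ((weight ξ)⁻¹ : ℝ)

lemma conjSymm_besselSym : ConjSymm besselSym := conjSymm_ofReal fun ξ => by rw [weight_neg]

lemma conjSymm_dxBesselSym : ConjSymm dxBesselSym := conjSymm_symDx.mul conjSymm_besselSym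

lemma norm_besselSym (ξ : Freq) : ‖besselSym ξ‖ = (weight ξ)⁻¹ := by
  have := weight_pos ξ
  rw [besselSym, Complex.norm_real, Real.norm_of_nonneg (by positivity)]

lemma norm_besselSym_le (ξ : Freq) : ‖besselSym ξ‖ ≤ 1 := by
  rw [norm_besselSym]; exact inv_le_one_of_one_le₀ (one_le_weight ξ)

lemma norm_dxBesselSym_le (ξ : Freq) : ‖dxBesselSym ξ‖ ≤ 1 := by
  have := weight_pos ξ
  rw [dxBesselSym, norm_mul, norm_symDx, Complex.norm_real, Real.norm_of_nonneg (by positivity),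
    ← div_eq_mul_inv]
  exact (div_le_one this).2 (abs_le_weight ξ)

/-- The Bessel potential `(1 - Δ)⁻¹`, which identifies `L²(𝕋²)` with `H²(𝕋²)`. -/
def bessel (a : L2) : L2 := mult besselSym a

/-- The operator `∂ₓ (1 - Δ)⁻¹`. -/
def dxBessel (a : L2) : L2 := mult dxBesselSym a

lemma coeff_bessel (a : L2) (ξ : Freq) : coeff (bessel a) ξ = besselSym ξ * coeff a ξ :=
  coeff_mult conjSymm_besselSym norm_besselSym_le a ξ

lemma coeff_dxBessel (a : L2) (ξ : Freq) : coeff (dxBessel a) ξ = dxBesselSym ξ * coeff a ξ :=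
  coeff_mult conjSymm_dxBesselSym norm_dxBesselSym_le a ξ

lemma norm_coeff_bessel (a : L2) (ξ : Freq) :
    ‖coeff (bessel a) ξ‖ = (weight ξ)⁻¹ * ‖coeff a ξ‖ := by
  rw [coeff_bessel, norm_mul, norm_besselSym]

lemma weight_mul_norm_coeff_bessel (a : L2) (ξ : Freq) :
    weight ξ * ‖coeff (bessel a) ξ‖ = ‖coeff a ξ‖ := by
  rw [norm_coeff_bessel, mul_inv_cancel_left₀ (weight_pos ξ).ne']

lemma hasSymbol_symDx_bessel (a : L2) : HasSymbol symDx (bessel a) (dxBessel a) := fun ξ => by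
  rw [coeff_bessel, coeff_dxBessel, dxBesselSym, besselSym, mul_assoc]

lemma norm_bessel_le (a : L2) : ‖bessel a‖ ≤ ‖a‖ :=
  (norm_mult_le conjSymm_besselSym norm_besselSym_le a).trans_eq (one_mul _)

lemma norm_dxBessel_le (a : L2) : ‖dxBessel a‖ ≤ ‖a‖ :=
  (norm_mult_le conjSymm_dxBesselSym norm_dxBesselSym_le a).trans_eq (one_mul _)

lemma bessel_sub (a b : L2) : bessel (a - b) = bessel a - bessel b :=
  mult_sub conjSymm_besselSym norm_besselSym_le a b

lemma dxBessel_sub (a b : L2) : dxBessel (a - b) = dxBessel a - dxBessel b :=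
  mult_sub conjSymm_dxBesselSym norm_dxBesselSym_le a b

lemma bessel_smul (c : ℝ) (a : L2) : bessel (c • a) = c • bessel a :=
  mult_smul conjSymm_besselSym norm_besselSym_le c a

lemma dxBessel_smul (c : ℝ) (a : L2) : dxBessel (c • a) = c • dxBessel a :=
  mult_smul conjSymm_dxBesselSym norm_dxBesselSym_le c a

lemma continuous_bessel : Continuous bessel := by
  refine (LipschitzWith.of_dist_le_mul (K := 1) fun a b => ?_).continuous
  rw [dist_eq_norm, dist_eq_norm, ← bessel_sub]
  simpa using norm_bessel_le (a - b)

lemma exists_bessel_eq {f : L2} (hf : MemSobolev 2 f) : ∃ a, bessel a = f := by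
  have hw : ConjSymm fun ξ => ((weight ξ : ℝ) : ℂ) := conjSymm_ofReal weight_neg
  have h := hasSymbol_mult hw (f := f) (by
    refine (memSobolev_iff.1 hf).congr fun ξ => ?_
    rw [norm_mul, mul_pow, Complex.norm_real, Real.norm_of_nonneg (weight_pos ξ).le])
  refine ⟨mult (fun ξ => ((weight ξ : ℝ) : ℂ)) f, ext_coeff fun ξ => ?_⟩
  rw [coeff_bessel, h ξ, besselSym]
  have : ((weight ξ : ℝ) : ℂ) ≠ 0 := by exact_mod_cast (weight_pos ξ).ne'
  push_cast
  field_simp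

lemma memSobolev_bessel (a : L2) : MemSobolev 2 (bessel a) := by
  refine memSobolev_iff.2 ((summable_sq_norm_coeff a).congr fun ξ => ?_)
  rw [← mul_pow, weight_mul_norm_coeff_bessel]

lemma sobolevENorm_bessel (a : L2) :
    sobolevENorm 2 (bessel a) = ENNReal.ofReal ((2 * Real.pi)⁻¹ * ‖a‖) := by
  have h : sobolevENorm 2 (bessel a) ^ 2 = ENNReal.ofReal ((2 * Real.pi)⁻¹ * ‖a‖) ^ 2 := by
    rw [sobolevENorm_sq]
    simp_rw [← mul_pow, weight_mul_norm_coeff_bessel]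
    rw [← ENNReal.ofReal_tsum_of_nonneg (fun _ => by positivity) (summable_sq_norm_coeff a),
      tsum_sq_norm_coeff, ← ENNReal.ofReal_pow (by positivity [Real.pi_pos])]
    congr 1
    ring
  exact (ENNReal.pow_right_strictMono two_ne_zero).injective h

lemma sq_norm_le_weight (ξ : Freq) : ‖ξ‖ ^ 2 ≤ weight ξ := by
  have h : ‖ξ‖ ≤ freqNorm ξ := by
    refine (pi_norm_le_iff_of_nonneg (freqNorm_nonneg ξ)).2 fun i => ?_
    rw [freqNorm, Int.norm_eq_abs]
    refine Real.abs_le_sqrt ?_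
    fin_cases i
    · simp; positivity
    · simp; positivity
  have := pow_le_pow_left₀ (norm_nonneg ξ) h 2
  unfold weight; linarith

lemma summable_inv_weight_sq : Summable fun ξ => (weight ξ)⁻¹ ^ 2 := by
  refine (EisensteinSeries.summable_one_div_norm_rpow (k := 4)
    (by norm_num)).of_norm_bounded_eventually ?_
  refine (Set.finite_singleton (0 : Freq)).subset fun ξ hξ => ?_
  by_contra h0
  refine hξ ?_
  have h1 := norm_pos_iff.2 h0
  have h2 := weight_pos ξ
  change ‖(weight ξ)⁻¹ ^ 2‖ ≤ ‖ξ‖ ^ (-4 : ℝ)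
  rw [Real.norm_of_nonneg (by positivity), Real.rpow_neg h1.le, inv_pow]
  refine inv_anti₀ (by positivity) ?_
  have := pow_le_pow_left₀ (by positivity) (sq_norm_le_weight ξ) 2
  calc ‖ξ‖ ^ (4 : ℝ) = (‖ξ‖ ^ 2) ^ 2 := by norm_cast; ring
    _ ≤ _ := this

lemma summable_abs_mul_inv_weight_sq :
    Summable fun ξ : Freq => |(ξ 0 : ℝ)| * (weight ξ)⁻¹ ^ 2 := by
  refine (EisensteinSeries.summable_one_div_norm_rpow (k := 3)
    (by norm_num)).of_nonneg_of_le (fun ξ => by have := weight_pos ξ; positivity) fun ξ => ?_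
  rcases eq_or_ne ξ 0 with rfl | h0
  · simp
  have h1 := norm_pos_iff.2 h0
  have h2 := weight_pos ξ
  have h3 : |(ξ 0 : ℝ)| ≤ ‖ξ‖ := norm_le_pi_norm ξ 0
  have h4 := pow_le_pow_left₀ (by positivity) (sq_norm_le_weight ξ) 2
  rw [Real.rpow_neg h1.le, inv_pow, ← div_eq_mul_inv, div_le_iff₀ (by positivity), inv_mul_eq_div,
    le_div_iff₀ (by positivity)]
  rw [show (3 : ℝ) = (3 : ℕ) by norm_num, Real.rpow_natCast]
  calc |(ξ 0 : ℝ)| * ‖ξ‖ ^ 3 ≤ ‖ξ‖ * ‖ξ‖ ^ 3 := by gcongr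
    _ = (‖ξ‖ ^ 2) ^ 2 := by ring
    _ ≤ _ := h4

/-- A constant of the Sobolev embedding of `H²(𝕋²)` into the functions with summable Fourier
coefficients. -/
def embConst : ℝ := √(∑' ξ, (weight ξ)⁻¹ ^ 2)

lemma embConst_nonneg : 0 ≤ embConst := Real.sqrt_nonneg _

lemma summable_norm_coeff_bessel_and_le (a : L2) :
    (Summable fun ξ => ‖coeff (bessel a) ξ‖) ∧
      ∑' ξ, ‖coeff (bessel a) ξ‖ ≤ embConst * ‖a‖ := by
  have h := Real.summable_and_inner_le_Lp_mul_Lq_tsum_of_nonneg Real.HolderConjugate.two_two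
    (f := fun ξ => (weight ξ)⁻¹) (g := fun ξ => ‖coeff a ξ‖)
    (fun ξ => by have := weight_pos ξ; positivity) (fun _ => norm_nonneg _)
    (by simpa using summable_inv_weight_sq) (by simpa using summable_sq_norm_coeff a)
  simp only [Real.rpow_two, ← Real.sqrt_eq_rpow, ← norm_coeff_bessel] at h
  refine ⟨h.1, h.2.trans ?_⟩
  unfold embConst
  gcongr
  exact Real.sqrt_le_iff.2 ⟨norm_nonneg _, tsum_sq_norm_coeff_le a⟩

/-- **Sobolev embedding** `H²(𝕋²) ⊂ L^∞(𝕋²)`. -/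
lemma ae_norm_bessel_le (a : L2) : ∀ᵐ p, ‖bessel a p‖ ≤ embConst * ‖a‖ := by
  obtain ⟨h1, h2⟩ := summable_norm_coeff_bessel_and_le a
  filter_upwards [ae_norm_le_tsum_norm_coeff h1] with p hp
  exact hp.trans h2

/-! ### Products and the transport term -/

/-- The product of two functions in `L²(𝕋²)`; it is `0` if the product is not in `L²(𝕋²)`. -/
def mulL2 (f g : L2) : L2 :=
  open Classical in if h : MemLp (fun p => f p * g p) 2 (volume : Measure Torus2) then h.toLp _
    else 0

lemma memLp_mul {f g : L2} {M : ℝ} (hf : ∀ᵐ p, ‖f p‖ ≤ M) :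
    MemLp (fun p => f p * g p) 2 (volume : Measure Torus2) := by
  refine MemLp.of_le_mul (c := M) (Lp.memLp g)
    ((Lp.aestronglyMeasurable f).mul (Lp.aestronglyMeasurable g)) ?_
  filter_upwards [hf] with p hp
  rw [norm_mul]
  gcongr

lemma coeFn_mulL2 {f g : L2} {M : ℝ} (hf : ∀ᵐ p, ‖f p‖ ≤ M) :
    mulL2 f g =ᵐ[volume] fun p => f p * g p := by
  rw [mulL2, dif_pos (memLp_mul hf)]
  exact MemLp.coeFn_toLp _

lemma norm_mulL2_le {f g : L2} {M : ℝ} (hf : ∀ᵐ p, ‖f p‖ ≤ M) : ‖mulL2 f g‖ ≤ M * ‖g‖ := by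
  refine Lp.norm_le_mul_norm_of_ae_le_mul ?_
  filter_upwards [coeFn_mulL2 (g := g) hf, hf] with p h1 h2
  rw [h1, norm_mul]
  gcongr

lemma coeff_mulL2 {f g : L2} {M : ℝ} (hf : ∀ᵐ p, ‖f p‖ ≤ M) (ξ : Freq) :
    coeff (mulL2 f g) ξ = funCoeff (fun p => f p * g p) ξ := by
  rw [coeff_eq_funCoeff, funCoeff_congr (coeFn_mulL2 hf)]

/-- The Leibniz rule, with values in the Fourier coefficients of integrable functions. -/
lemma funCoeff_leibniz {f f' g g' : L2} (hf : HasSymbol symDx f f') (hg : HasSymbol symDx g g')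
    (ξ : Freq) : funCoeff (fun p => f' p * g p) ξ + funCoeff (fun p => f p * g' p) ξ =
      symDx ξ * funCoeff (fun p => f p * g p) ξ := by
  refine ((hasSum_funCoeff_mul f' g ξ).add (hasSum_funCoeff_mul f g' ξ)).unique ?_
  refine ((hasSum_funCoeff_mul f g ξ).mul_left (symDx ξ)).congr_fun fun η => ?_
  rw [hf, hg]
  simp only [symDx, Pi.sub_apply]
  push_cast
  ring

/-- The transport term `u uₓ` of `u = (1 - Δ)⁻¹ a`. -/
def transport (a : L2) : L2 := mulL2 (bessel a) (dxBessel a)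

lemma coeFn_transport (a : L2) : transport a =ᵐ[volume] fun p => bessel a p * dxBessel a p :=
  coeFn_mulL2 (ae_norm_bessel_le a)

/-- The conservative form `u uₓ = ½ ∂ₓ(u²)` of the transport term. -/
lemma coeff_transport (a : L2) (ξ : Freq) : coeff (transport a) ξ =
    symDx ξ / 2 * funCoeff (fun p => bessel a p * bessel a p) ξ := by
  have h := funCoeff_leibniz (hasSymbol_symDx_bessel a) (hasSymbol_symDx_bessel a) ξ
  rw [transport, coeff_mulL2 (ae_norm_bessel_le a)]
  have h2 : (fun p => dxBessel a p * bessel a p) = fun p => bessel a p * dxBessel a p := by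
    ext p; ring
  rw [h2] at h
  linear_combination h / 2

lemma norm_funCoeff_mul_self_le (f : L2) (ξ : Freq) :
    ‖funCoeff (fun p => f p * f p) ξ‖ ≤ ‖f‖ ^ 2 := by
  have hs := summable_sq_norm_coeff f
  have hsum : HasSum (fun η => (‖coeff f (ξ - η)‖ ^ 2 + ‖coeff f η‖ ^ 2) / 2)
      ((((2 * Real.pi) ^ 2)⁻¹ * ‖f‖ ^ 2 + ((2 * Real.pi) ^ 2)⁻¹ * ‖f‖ ^ 2) / 2) := by
    refine HasSum.div_const (HasSum.add ?_ (hasSum_sq_norm_coeff f)) 2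
    exact (Equiv.subLeft ξ).hasSum_iff.2 (hasSum_sq_norm_coeff f)
  rw [← (hasSum_funCoeff_mul f f ξ).tsum_eq]
  refine (tsum_of_norm_bounded hsum fun η => ?_).trans ?_
  · rw [norm_mul]
    nlinarith [sq_nonneg (‖coeff f (ξ - η)‖ - ‖coeff f η‖)]
  · nlinarith [sq_nonneg ‖f‖, inv_two_pi_sq_le_one]

lemma norm_coeff_transport_le (a : L2) (ξ : Freq) :
    ‖coeff (transport a) ξ‖ ≤ |(ξ 0 : ℝ)| * ‖bessel a‖ ^ 2 := by
  rw [coeff_transport, norm_mul, norm_div, norm_symDx, Complex.norm_ofNat]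
  have := norm_funCoeff_mul_self_le (bessel a) ξ
  have h0 := abs_nonneg (ξ 0 : ℝ)
  calc |(ξ 0 : ℝ)| / 2 * ‖funCoeff (fun p => bessel a p * bessel a p) ξ‖
      ≤ |(ξ 0 : ℝ)| * ‖funCoeff (fun p => bessel a p * bessel a p) ξ‖ := by
        gcongr; linarith
    _ ≤ _ := by gcongr

/-- The transport term does not contribute to the balance of the `L²` norm: `∫ u² uₓ = 0`, as
`3 u² uₓ` is the derivative of `u³`. -/
lemma inner_bessel_transport (a : L2) : inner ℝ (bessel a) (transport a) = 0 := by
  have hu := ae_norm_bessel_le a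
  set u := bessel a
  have hsq : HasSymbol symDx (mulL2 u u) ((2 : ℝ) • transport a) := fun ξ => by
    rw [coeff_smul, coeff_transport, coeff_mulL2 hu]
    push_cast; ring
  have h := funCoeff_leibniz hsq (hasSymbol_symDx_bessel a) 0
  have e1 : funCoeff (fun p => ((2 : ℝ) • transport a) p * u p) 0 =
      2 * funCoeff (fun p => u p * transport a p) 0 := by
    rw [funCoeff, funCoeff, mul_left_comm, ← integral_const_mul (2 : ℂ)]
    congr 1
    refine integral_congr_ae ?_
    filter_upwards [Lp.coeFn_smul (2 : ℝ) (transport a)] with p hp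
    rw [hp]
    simp only [Pi.smul_apply, smul_eq_mul]
    push_cast; ring
  have e2 : funCoeff (fun p => mulL2 u u p * dxBessel a p) 0 =
      funCoeff (fun p => u p * transport a p) 0 := by
    refine funCoeff_congr ?_ 0
    filter_upwards [coeFn_transport a, coeFn_mulL2 (g := u) hu] with p h1 h2
    rw [h1, h2]; ring
  have e3 : symDx 0 = 0 := by simp [symDx]
  rw [show bessel a = u from rfl, e1, e2, e3, zero_mul] at h
  have h0 : funCoeff (fun p => u p * transport a p) 0 = 0 := by linear_combination h / 3
  have hpi : (Real.pi : ℂ) ≠ 0 := by exact_mod_cast Real.pi_ne_zero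
  rw [funCoeff, neg_zero] at h0
  simp only [char_zero, one_mul] at h0
  have h1 : ∫ p, (((u p * transport a p : ℝ)) : ℂ) = 0 := by
    rcases mul_eq_zero.1 h0 with h | h
    · simp [hpi] at h
    · exact h
  rw [integral_complex_ofReal] at h1
  rw [L2.inner_def]
  have h2 : ∫ p, u p * transport a p = 0 := by exact_mod_cast h1
  rw [← h2]
  refine integral_congr_ae (Eventually.of_forall fun p => ?_)
  simp [mul_comm]

lemma transport_smul (c : ℝ) (a : L2) : transport (c • a) = c ^ 2 • transport a := by
  ext1
  filter_upwards [coeFn_transport (c • a), coeFn_transport a, Lp.coeFn_smul (c ^ 2) (transport a),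
    Lp.coeFn_smul c (bessel a), Lp.coeFn_smul c (dxBessel a)] with p h1 h2 h3 h4 h5
  rw [h1, h3, bessel_smul, dxBessel_smul, h4, h5]
  simp only [Pi.smul_apply, smul_eq_mul, h2]
  ring

/-- The transport term is locally Lipschitz from `H²(𝕋²)` to `L²(𝕋²)`. -/
lemma norm_transport_sub_le (a b : L2) :
    ‖transport a - transport b‖ ≤ embConst * (‖a‖ + ‖b‖) * ‖a - b‖ := by
  have e : transport a - transport b =
      mulL2 (bessel (a - b)) (dxBessel a) + mulL2 (bessel b) (dxBessel (a - b)) := by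
    ext1
    filter_upwards [coeFn_transport a, coeFn_transport b, Lp.coeFn_sub (transport a) (transport b),
      coeFn_mulL2 (g := dxBessel a) (ae_norm_bessel_le (a - b)),
      coeFn_mulL2 (g := dxBessel (a - b)) (ae_norm_bessel_le b),
      Lp.coeFn_add (mulL2 (bessel (a - b)) (dxBessel a)) (mulL2 (bessel b) (dxBessel (a - b))),
      Lp.coeFn_sub (bessel a) (bessel b), Lp.coeFn_sub (dxBessel a) (dxBessel b)]
      with p h1 h2 h3 h4 h5 h6 h7 h8
    rw [h3, h6, Pi.add_apply, h4, h5, bessel_sub, dxBessel_sub, h7, h8]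
    simp only [Pi.sub_apply, h1, h2]
    ring
  rw [e]
  have h1 := norm_mulL2_le (g := dxBessel a) (ae_norm_bessel_le (a - b))
  have h2 := norm_mulL2_le (g := dxBessel (a - b)) (ae_norm_bessel_le b)
  have hE := embConst_nonneg
  calc _ ≤ _ := norm_add_le _ _
    _ ≤ embConst * ‖a - b‖ * ‖a‖ + embConst * ‖b‖ * ‖a - b‖ := by
        refine add_le_add (h1.trans ?_) (h2.trans ?_)
        · gcongr; exact norm_dxBessel_le a
        · gcongr; exact norm_dxBessel_le _
    _ = _ := by ring

lemma continuous_transport : Continuous transport := by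
  rw [continuous_iff_continuousAt]
  intro b
  rw [ContinuousAt, tendsto_iff_norm_sub_tendsto_zero]
  refine squeeze_zero (fun _ => norm_nonneg _) (fun a => norm_transport_sub_le a b) ?_
  have : Continuous fun a : L2 => embConst * (‖a‖ + ‖b‖) * ‖a - b‖ := by fun_prop
  simpa using this.tendsto b

/-! ### Volterra equations with an integrable kernel -/

section Volterra

variable {X : Type*} [NormedAddCommGroup X] [NormedSpace ℝ X]

/-- A family of operators on a Banach space, homogeneous and Lipschitz with an integrable
constant, that can serve as the kernel of a convolution on `[0, T]`. -/
structure VolterraKernel (T : ℝ) (K : ℝ → X → X) (k : ℝ → ℝ) : Prop where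
  lipschitz : ∀ s ∈ Ioc 0 T, ∀ x y, ‖K s x - K s y‖ ≤ k s * ‖x - y‖
  smul : ∀ s ∈ Ioc 0 T, ∀ (c : ℝ) x, K s (c • x) = c • K s x
  measurable : ∀ f : ℝ → X, Continuous f →
    AEStronglyMeasurable (fun s => K s (f s)) (volume.restrict (Ioc 0 T))
  nonneg : ∀ s, 0 ≤ k s
  integrable : IntegrableOn k (Ioc 0 T)

namespace VolterraKernel

variable {T : ℝ} {K : ℝ → X → X} {k : ℝ → ℝ}

lemma norm_le (h : VolterraKernel T K k) {s : ℝ} (hs : s ∈ Ioc 0 T) (x : X) :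
    ‖K s x‖ ≤ k s * ‖x‖ := by
  have h0 : K s 0 = 0 := by simpa using h.smul s hs 0 0
  simpa [h0] using h.lipschitz s hs x 0

lemma continuous (h : VolterraKernel T K k) {s : ℝ} (hs : s ∈ Ioc 0 T) :
    Continuous (K s) := by
  refine (LipschitzWith.of_dist_le_mul (K := ⟨k s, h.nonneg s⟩) fun x y => ?_).continuous
  rw [dist_eq_norm, dist_eq_norm]
  exact h.lipschitz s hs x y

/-- The exponentially damped kernel. -/
lemma exp_smul (h : VolterraKernel T K k) {l : ℝ} (hl : 0 ≤ l) :
    VolterraKernel T (fun s x => Real.exp (-(l * s)) • K s x)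
      (fun s => Real.exp (-(l * s)) * k s) where
  lipschitz s hs x y := by
    rw [← smul_sub, norm_smul, Real.norm_of_nonneg (Real.exp_pos _).le, mul_assoc]
    gcongr
    exact h.lipschitz s hs x y
  smul s hs c x := by rw [h.smul s hs, smul_comm]
  measurable f hf := by
    have : Continuous fun s : ℝ => Real.exp (-(l * s)) := by fun_prop
    exact this.aestronglyMeasurable.smul (h.measurable f hf)
  nonneg s := mul_nonneg (Real.exp_pos _).le (h.nonneg s)
  integrable := by
    have hc : Continuous fun s : ℝ => Real.exp (-(l * s)) := by fun_prop
    refine h.integrable.mono' (hc.aestronglyMeasurable.mul h.integrable.1) ?_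
    filter_upwards [ae_restrict_mem measurableSet_Ioc] with s hs
    rw [Real.norm_of_nonneg (mul_nonneg (Real.exp_pos _).le (h.nonneg s))]
    refine mul_le_of_le_one_left (h.nonneg s) (Real.exp_le_one_iff.2 ?_)
    have := mul_nonneg hl hs.1.le
    linarith

lemma integrable_conv (h : VolterraKernel T K k) {f : ℝ → X} (hf : Continuous f) :
    IntegrableOn (fun s => K s (f s)) (Ioc 0 T) := by
  obtain ⟨M, hM⟩ := (isCompact_Icc (a := (0 : ℝ)) (b := T)).exists_bound_of_continuousOn
    hf.continuousOn
  refine (h.integrable.mul_const M).mono' (h.measurable f hf) ?_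
  filter_upwards [ae_restrict_mem measurableSet_Ioc] with s hs
  refine (h.norm_le hs _).trans ?_
  exact mul_le_mul_of_nonneg_left (hM s ⟨hs.1.le, hs.2⟩) (h.nonneg s)

lemma continuousOn_conv (h : VolterraKernel T K k) {f : ℝ → X} (hf : Continuous f) :
    ContinuousOn (fun t => ∫ s in (0 : ℝ)..t, K s (f (t - s))) (Icc 0 T) := by
  have e : ∀ t ∈ Icc 0 T, ∫ s in (0 : ℝ)..t, K s (f (t - s)) =
      ∫ s in Ioc 0 T, (Iic t).indicator (fun s => K s (f (t - s))) s := by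
    intro t ht
    rw [intervalIntegral.integral_of_le ht.1, setIntegral_indicator measurableSet_Iic]
    congr 2
    ext s
    simp only [mem_Ioc, mem_inter_iff, mem_Iic]
    have := ht.2
    constructor <;> intro hs
    · exact ⟨⟨hs.1, by linarith⟩, hs.2⟩
    · exact ⟨hs.1.1, hs.2⟩
  obtain ⟨M, hM⟩ := (isCompact_Icc (a := -T) (b := T)).exists_bound_of_continuousOn
    hf.continuousOn
  refine ContinuousOn.congr (fun t₀ ht₀ => ?_) e
  refine tendsto_integral_filter_of_dominated_convergence (fun s => k s * M) ?_ ?_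
    (h.integrable.mul_const M) ?_
  · refine Eventually.of_forall fun t => ?_
    exact (h.measurable (fun s => f (t - s)) (by fun_prop)).indicator measurableSet_Iic
  · filter_upwards [self_mem_nhdsWithin] with t ht
    filter_upwards [ae_restrict_mem measurableSet_Ioc] with s hs
    refine (norm_indicator_le_norm_self _ _).trans ((h.norm_le hs _).trans ?_)
    refine mul_le_mul_of_nonneg_left (hM _ ⟨?_, ?_⟩) (h.nonneg s)
    · linarith [ht.1, hs.2]
    · linarith [ht.2, hs.1]
  · have hne : ∀ᵐ s ∂volume.restrict (Ioc 0 T), s ≠ t₀ :=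
      ae_restrict_of_ae (Measure.ae_ne volume t₀)
    filter_upwards [ae_restrict_mem measurableSet_Ioc, hne] with s hs hst
    rcases lt_or_gt_of_ne hst with hlt | hgt
    · have h1 : Tendsto (fun t => K s (f (t - s))) (𝓝[Icc 0 T] t₀) (𝓝 (K s (f (t₀ - s)))) :=
        (((h.continuous hs).comp hf).comp (continuous_id.sub continuous_const)).continuousAt.tendsto
          |>.mono_left nhdsWithin_le_nhds
      rw [indicator_of_mem (show s ∈ Iic t₀ from hlt.le)]
      refine h1.congr' ?_
      filter_upwards [mem_nhdsWithin_of_mem_nhds (Ioi_mem_nhds hlt)] with t ht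
      rw [indicator_of_mem (show s ∈ Iic t from (mem_Ioi.1 ht).le)]
    · rw [indicator_of_notMem (show s ∉ Iic t₀ from not_le.2 hgt)]
      refine tendsto_const_nhds.congr' ?_
      filter_upwards [mem_nhdsWithin_of_mem_nhds (Iio_mem_nhds hgt)] with t ht
      rw [indicator_of_notMem (show s ∉ Iic t from not_le.2 (mem_Iio.1 ht))]

/-- Damping makes the total mass of the kernel small. -/
lemma exists_damping (h : VolterraKernel T K k) {c : ℝ} (hc : 0 < c) :
    ∃ l : ℝ, 0 ≤ l ∧ ∫ s in Ioc 0 T, Real.exp (-(l * s)) * k s < c := by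
  have h1 : Tendsto (fun l : ℝ => ∫ s in Ioc 0 T, Real.exp (-(l * s)) * k s) atTop
      (𝓝 (∫ s in Ioc 0 T, (0 : ℝ))) := by
    refine tendsto_integral_filter_of_dominated_convergence k ?_ ?_ h.integrable ?_
    · filter_upwards [eventually_ge_atTop 0] with l hl
      exact (h.exp_smul hl).integrable.1
    · filter_upwards [eventually_ge_atTop 0] with l hl
      filter_upwards [ae_restrict_mem measurableSet_Ioc] with s hs
      rw [Real.norm_of_nonneg (mul_nonneg (Real.exp_pos _).le (h.nonneg s))]
      refine mul_le_of_le_one_left (h.nonneg s) (Real.exp_le_one_iff.2 ?_)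
      have := mul_nonneg hl hs.1.le
      linarith
    · filter_upwards [ae_restrict_mem measurableSet_Ioc] with s hs
      have : Tendsto (fun l : ℝ => Real.exp (-(l * s))) atTop (𝓝 0) :=
        Real.tendsto_exp_neg_atTop_nhds_zero.comp (tendsto_id.atTop_mul_const hs.1)
      simpa using this.mul_const (k s)
  rw [integral_zero] at h1
  obtain ⟨l, hl0, hl⟩ := ((eventually_ge_atTop 0).and (h1.eventually (gt_mem_nhds hc))).exists
  exact ⟨l, hl0, hl⟩

/-- The Volterra equation `a(t) = g(t) + ∫₀ᵗ K(s) F(a(t - s)) ds` with a globally Lipschitz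
nonlinearity `F` has a continuous solution on `[0, T]`. -/
theorem exists_solution [CompleteSpace X] (h : VolterraKernel T K k) (hT : 0 ≤ T) {F : X → X}
    {L : NNReal} (hF : LipschitzWith L F) {g : ℝ → X} (hg : Continuous g) :
    ∃ a : ℝ → X, Continuous a ∧
      ∀ t ∈ Icc 0 T, a t = g t + ∫ s in (0 : ℝ)..t, K s (F (a (t - s))) := by
  obtain ⟨l, hl0, hl⟩ := h.exists_damping (c := 1 / (L + 1)) (by positivity)
  have hd := h.exp_smul hl0
  -- With `a(t) = e^{l t} b(t)` the equation has the damped kernel and the nonlinearity below.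
  let H : C(Icc 0 T, X) → ℝ → X := fun b r =>
    Real.exp (-(l * r)) • F (Real.exp (l * r) • b (projIcc 0 T hT r))
  have hH : ∀ b, Continuous (H b) := fun b => by
    have h1 : Continuous fun r => b (projIcc 0 T hT r) := b.continuous.comp continuous_projIcc
    have h2 : Continuous fun r : ℝ => Real.exp (l * r) := by fun_prop
    have h3 : Continuous fun r : ℝ => Real.exp (-(l * r)) := by fun_prop
    exact h3.smul (hF.continuous.comp (h2.smul h1))
  have hHsub : ∀ b b' r, ‖H b r - H b' r‖ ≤ L * ‖b - b'‖ := fun b b' r => by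
    simp only [H]
    rw [← smul_sub, norm_smul, Real.norm_of_nonneg (Real.exp_pos _).le]
    calc _ ≤ Real.exp (-(l * r)) * (L * ‖Real.exp (l * r) • b (projIcc 0 T hT r) -
          Real.exp (l * r) • b' (projIcc 0 T hT r)‖) := by
          gcongr; exact hF.norm_sub_le _ _
      _ = L * ‖(b - b') (projIcc 0 T hT r)‖ := by
          rw [← smul_sub, norm_smul, Real.norm_of_nonneg (Real.exp_pos _).le,
            ContinuousMap.sub_apply]
          have : Real.exp (-(l * r)) * Real.exp (l * r) = 1 := by
            rw [← Real.exp_add]; simp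
          linear_combination (L * ‖b (projIcc 0 T hT r) - b' (projIcc 0 T hT r)‖) * this
      _ ≤ _ := by gcongr; exact (b - b').norm_coe_le_norm _
  let Φ : C(Icc 0 T, X) → C(Icc 0 T, X) := fun b =>
    { toFun := fun t => Real.exp (-(l * t)) • g t +
        ∫ s in (0 : ℝ)..t, Real.exp (-(l * s)) • K s (H b (t - s))
      continuous_toFun := by
        have h1 : Continuous fun t : ℝ => Real.exp (-(l * t)) • g t :=
          Continuous.smul (by fun_prop) hg
        exact (h1.comp continuous_subtype_val).add
          (continuousOn_iff_continuous_domRestrict.1 (hd.continuousOn_conv (hH b))) }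
  have hint : ∀ b (t : Icc 0 T), IntervalIntegrable
      (fun s => Real.exp (-(l * s)) • K s (H b (t - s))) volume 0 t := fun b t => by
    rw [intervalIntegrable_iff_integrableOn_Ioc_of_le t.2.1]
    exact (hd.integrable_conv (f := fun s => H b (t - s))
      ((hH b).comp (continuous_const.sub continuous_id))).mono_set (Ioc_subset_Ioc_right t.2.2)
  have hΦ : ContractingWith (L / (L + 1)) Φ := by
    refine ⟨?_, LipschitzWith.of_dist_le_mul fun b b' => ?_⟩
    · rw [div_lt_one (by positivity)]
      exact lt_add_one L
    rw [dist_eq_norm, dist_eq_norm, ContinuousMap.norm_le _ (by positivity)]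
    intro t
    simp only [Φ, ContinuousMap.sub_apply, ContinuousMap.coe_mk, add_sub_add_left_eq_sub]
    rw [← intervalIntegral.integral_sub (hint b t) (hint b' t),
      intervalIntegral.integral_of_le t.2.1]
    calc ‖∫ s in Ioc 0 (t : ℝ), (Real.exp (-(l * s)) • K s (H b (t - s)) -
            Real.exp (-(l * s)) • K s (H b' (t - s)))‖
        ≤ ∫ s in Ioc 0 (t : ℝ), Real.exp (-(l * s)) * k s * (L * ‖b - b'‖) := by
          refine norm_integral_le_of_norm_le
            ((hd.integrable.mono_set (Ioc_subset_Ioc_right t.2.2)).mul_const _) ?_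
          filter_upwards [ae_restrict_mem measurableSet_Ioc] with s hs
          refine (hd.lipschitz s ⟨hs.1, hs.2.trans t.2.2⟩ _ _).trans ?_
          exact mul_le_mul_of_nonneg_left (hHsub b b' _) (hd.nonneg s)
      _ ≤ ∫ s in Ioc 0 T, Real.exp (-(l * s)) * k s * (L * ‖b - b'‖) := by
          refine setIntegral_mono_set (hd.integrable.mul_const _) ?_
            (Ioc_subset_Ioc_right t.2.2).eventuallyLE
          exact Eventually.of_forall fun s => mul_nonneg (hd.nonneg s) (by positivity)
      _ = (∫ s in Ioc 0 T, Real.exp (-(l * s)) * k s) * (L * ‖b - b'‖) :=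
          integral_mul_const _ _
      _ ≤ 1 / (L + 1) * (L * ‖b - b'‖) := by gcongr
      _ = _ := by push_cast; ring
  obtain ⟨b, hb⟩ : ∃ b, Φ b = b := ⟨_, hΦ.fixedPoint_isFixedPt⟩
  refine ⟨fun t => Real.exp (l * t) • b (projIcc 0 T hT t), ?_, fun t ht => ?_⟩
  · have h1 : Continuous fun r => b (projIcc 0 T hT r) := b.continuous.comp continuous_projIcc
    exact Continuous.smul (by fun_prop) h1
  have hbt : b (projIcc 0 T hT t) = Real.exp (-(l * t)) • g t +
      ∫ s in (0 : ℝ)..t, Real.exp (-(l * s)) • K s (H b (t - s)) := by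
    conv_lhs => rw [← hb]
    rw [projIcc_of_mem hT ht]
    rfl
  beta_reduce
  rw [hbt, smul_add, smul_smul, ← Real.exp_add, add_neg_cancel, Real.exp_zero, one_smul,
    ← intervalIntegral.integral_smul]
  congr 1
  rw [intervalIntegral.integral_of_le ht.1, intervalIntegral.integral_of_le ht.1]
  refine setIntegral_congr_fun measurableSet_Ioc fun s hs => ?_
  simp only [H]
  rw [smul_smul, ← h.smul s ⟨hs.1, hs.2.trans ht.2⟩, smul_smul, ← Real.exp_add, ← Real.exp_add,
    show l * t + -(l * s) + -(l * (t - s)) = 0 by ring, Real.exp_zero, one_smul]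

end VolterraKernel

end Volterra

/-! ### The semigroup of a fourth-order parabolic operator -/

/-- `p` is a real even symbol comparable to `-|ξ|⁴` at high frequencies, the weight being
`1 + |ξ|²`. -/
structure IsParabolic (p : Freq → ℝ) (c C B : ℝ) : Prop where
  even : ∀ ξ, p (-ξ) = p ξ
  c_pos : 0 < c
  C_nonneg : 0 ≤ C
  le : ∀ ξ, p ξ ≤ C - c * weight ξ ^ 2
  abs_le : ∀ ξ, |p ξ| ≤ B * weight ξ ^ 2

/-- The symbol of the semigroup generated by the operator with symbol `p`. -/
def semigroupSym (p : Freq → ℝ) (t : ℝ) (ξ : Freq) : ℂ := (Real.exp (t * p ξ) : ℝ)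

/-- The symbol of `1 - Δ` composed with the semigroup generated by the operator with
symbol `p`. -/
def kernelSym (p : Freq → ℝ) (t : ℝ) (ξ : Freq) : ℂ := (weight ξ * Real.exp (t * p ξ) : ℝ)

/-- A bound of the operator norm of the multiplier with symbol `kernelSym p s` for `s ≤ T`. -/
def kernelBound (c C T s : ℝ) : ℝ := Real.exp (C * T) * (√c)⁻¹ * (√s)⁻¹

lemma kernelBound_nonneg (c C T s : ℝ) : 0 ≤ kernelBound c C T s := by
  unfold kernelBound; positivity

lemma integrableOn_kernelBound (c C T : ℝ) : IntegrableOn (kernelBound c C T) (Ioc 0 T) := by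
  rcases le_or_gt T 0 with hT | hT
  · simp [Ioc_eq_empty_of_le hT]
  have h : IntegrableOn (fun s : ℝ => s ^ (-(1 / 2) : ℝ)) (Ioc 0 T) :=
    (intervalIntegrable_iff_integrableOn_Ioc_of_le hT.le).1
      (intervalIntegral.intervalIntegrable_rpow' (by norm_num))
  refine IntegrableOn.congr_fun (h.const_mul (Real.exp (C * T) * (√c)⁻¹)) (fun s hs => ?_)
    measurableSet_Ioc
  simp only [kernelBound]
  rw [Real.rpow_neg hs.1.le, ← Real.sqrt_eq_rpow s]

namespace IsParabolic

variable {p : Freq → ℝ} {c C B : ℝ}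

lemma le_C (h : IsParabolic p c C B) (ξ : Freq) : p ξ ≤ C := by
  have h1 := h.le ξ
  have h2 := mul_nonneg h.c_pos.le (sq_nonneg (weight ξ))
  linarith

lemma conjSymm_semigroupSym (h : IsParabolic p c C B) (t : ℝ) : ConjSymm (semigroupSym p t) :=
  conjSymm_ofReal fun ξ => by rw [h.even]

lemma conjSymm_kernelSym (h : IsParabolic p c C B) (t : ℝ) : ConjSymm (kernelSym p t) :=
  conjSymm_ofReal fun ξ => by rw [h.even, weight_neg]

lemma exp_le (h : IsParabolic p c C B) {t T : ℝ} (h0 : 0 ≤ t) (hT : t ≤ T) (ξ : Freq) :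
    Real.exp (t * p ξ) ≤ Real.exp (C * T) := by
  refine Real.exp_le_exp.2 ?_
  have h1 := h.le_C ξ
  have h2 := h.C_nonneg
  nlinarith

lemma norm_semigroupSym_le (h : IsParabolic p c C B) {t T : ℝ} (h0 : 0 ≤ t) (hT : t ≤ T)
    (ξ : Freq) : ‖semigroupSym p t ξ‖ ≤ Real.exp (C * T) := by
  rw [semigroupSym, Complex.norm_real, Real.norm_of_nonneg (Real.exp_pos _).le]
  exact h.exp_le h0 hT ξ

/-- The smoothing estimate of the semigroup: a gain of two derivatives costs `s^{-1/2}`, because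
`√y e^{-y}` is bounded for `y = c s (1 + |ξ|²)²`. -/
lemma norm_kernelSym_le (h : IsParabolic p c C B) {s T : ℝ} (h0 : 0 < s) (hT : s ≤ T)
    (ξ : Freq) : ‖kernelSym p s ξ‖ ≤ kernelBound c C T s := by
  have hw := weight_pos ξ
  have hc := h.c_pos
  rw [kernelSym, Complex.norm_real, Real.norm_of_nonneg (by positivity), kernelBound, mul_assoc,
    ← mul_inv, ← div_eq_mul_inv, le_div_iff₀ (by positivity)]
  set r := √c * √s with hr
  have hr2 : r ^ 2 = c * s := by
    rw [hr, mul_pow, Real.sq_sqrt hc.le, Real.sq_sqrt h0.le]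
  have hr0 : 0 < r := by positivity
  have h1 : weight ξ * r ≤ Real.exp ((weight ξ * r) ^ 2) := by
    refine le_trans ?_ (Real.add_one_le_exp _)
    nlinarith [sq_nonneg (weight ξ * r - 1)]
  have h2 : s * p ξ ≤ C * T - (weight ξ * r) ^ 2 := by
    rw [mul_pow, hr2]
    have := mul_le_mul_of_nonneg_left (h.le ξ) h0.le
    have h3 := h.C_nonneg
    nlinarith
  calc weight ξ * Real.exp (s * p ξ) * r = weight ξ * r * Real.exp (s * p ξ) := by ring
    _ ≤ Real.exp ((weight ξ * r) ^ 2) * Real.exp (C * T - (weight ξ * r) ^ 2) := by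
        gcongr
    _ = Real.exp (C * T) := by rw [← Real.exp_add]; congr 1; ring

lemma volterraKernel (h : IsParabolic p c C B) (T : ℝ) :
    VolterraKernel T (fun s => mult (kernelSym p s)) (kernelBound c C T) where
  lipschitz s hs x y := by
    have hb := h.norm_kernelSym_le hs.1 hs.2
    rw [← mult_sub (h.conjSymm_kernelSym s) hb]
    exact norm_mult_le (h.conjSymm_kernelSym s) hb _
  smul s hs r x := mult_smul (h.conjSymm_kernelSym s) (h.norm_kernelSym_le hs.1 hs.2) r x
  measurable f hf := by
    refine ContinuousOn.aestronglyMeasurable (fun s₀ hs₀ => ?_) measurableSet_Ioc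
    have hmono : ∀ s, s₀ / 2 ≤ s → kernelBound c C T s ≤ kernelBound c C T (s₀ / 2) := by
      intro s hs
      have := hs₀.1
      unfold kernelBound
      gcongr
    refine tendsto_mult (C := kernelBound c C T (s₀ / 2)) h.conjSymm_kernelSym
      (h.conjSymm_kernelSym s₀) ?_ ?_ (fun ξ => ?_) (hf.tendsto s₀ |>.mono_left nhdsWithin_le_nhds)
    · filter_upwards [self_mem_nhdsWithin,
        mem_nhdsWithin_of_mem_nhds (Ioi_mem_nhds (half_lt_self hs₀.1))] with s hs hs' ξ
      exact (h.norm_kernelSym_le hs.1 hs.2 ξ).trans (hmono s (mem_Ioi.1 hs').le)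
    · exact fun ξ => (h.norm_kernelSym_le hs₀.1 hs₀.2 ξ).trans
        (hmono s₀ (half_lt_self hs₀.1).le)
    · have : Continuous fun s => kernelSym p s ξ := by
        unfold kernelSym; fun_prop
      exact this.continuousAt.tendsto.mono_left nhdsWithin_le_nhds
  nonneg := kernelBound_nonneg c C T
  integrable := integrableOn_kernelBound c C T

lemma continuous_semigroup (h : IsParabolic p c C B) (a : L2) :
    Continuous fun t : ℝ => mult (semigroupSym p (max t 0)) a := by
  refine continuous_iff_continuousAt.2 fun t₀ => ?_
  refine tendsto_mult (C := Real.exp (C * (max t₀ 0 + 1)))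
    (fun t => h.conjSymm_semigroupSym (max t 0)) (h.conjSymm_semigroupSym _) ?_ ?_ (fun ξ => ?_)
    tendsto_const_nhds
  · have : Tendsto (fun t : ℝ => max t 0) (𝓝 t₀) (𝓝 (max t₀ 0)) :=
      (continuous_id.max continuous_const).tendsto t₀
    filter_upwards [this.eventually (gt_mem_nhds (lt_add_one _))] with t ht ξ
    exact h.norm_semigroupSym_le (le_max_right _ _) ht.le ξ
  · exact fun ξ => h.norm_semigroupSym_le (le_max_right _ _) (by linarith) ξ
  · have : Continuous fun t : ℝ => semigroupSym p (max t 0) ξ := by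
      unfold semigroupSym; fun_prop
    exact this.continuousAt.tendsto

end IsParabolic

/-! ### Truncated mild solutions -/

/-- The radial retraction onto the closed ball of radius `R`. -/
def radial (R : ℝ) (a : L2) : L2 := (R / max R ‖a‖) • a

lemma norm_radial_le {R : ℝ} (hR : 0 < R) (a : L2) : ‖radial R a‖ ≤ R := by
  have hm : 0 < max R ‖a‖ := hR.trans_le (le_max_left _ _)
  rw [radial, norm_smul, Real.norm_of_nonneg (by positivity), div_mul_eq_mul_div,
    div_le_iff₀ hm]
  gcongr
  exact le_max_right _ _

lemma norm_radial_sub_le {R : ℝ} (hR : 0 < R) (a b : L2) :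
    ‖radial R a - radial R b‖ ≤ 2 * ‖a - b‖ := by
  have hma : 0 < max R ‖a‖ := hR.trans_le (le_max_left _ _)
  have hmb : 0 < max R ‖b‖ := hR.trans_le (le_max_left _ _)
  have hRa : R / max R ‖a‖ ≤ 1 := (div_le_one hma).2 (le_max_left _ _)
  have hdiff : |max R ‖b‖ - max R ‖a‖| ≤ ‖a - b‖ := by
    refine (abs_max_sub_max_le_max R ‖b‖ R ‖a‖).trans ?_
    simp only [sub_self, abs_zero]
    refine max_le (norm_nonneg _) ?_
    rw [norm_sub_rev a b]
    exact abs_norm_sub_norm_le b a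
  have e : radial R a - radial R b = (R / max R ‖a‖) • (a - b) +
      (R / max R ‖a‖ * ((max R ‖b‖ - max R ‖a‖) / max R ‖b‖)) • b := by
    have : R / max R ‖b‖ =
        R / max R ‖a‖ - R / max R ‖a‖ * ((max R ‖b‖ - max R ‖a‖) / max R ‖b‖) := by
      field_simp; ring
    rw [radial, radial, this]
    module
  rw [e]
  refine (norm_add_le _ _).trans ?_
  rw [norm_smul, norm_smul, norm_mul, Real.norm_of_nonneg
    (show 0 ≤ R / max R ‖a‖ by positivity), norm_div, Real.norm_eq_abs (_ - _),
    Real.norm_of_nonneg hmb.le]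
  have h1 : |max R ‖b‖ - max R ‖a‖| / max R ‖b‖ * ‖b‖ ≤ ‖a - b‖ := by
    rw [div_mul_eq_mul_div, div_le_iff₀ hmb]
    gcongr
    exact le_max_right _ _
  have h2 := mul_le_mul hRa h1 (by positivity) zero_le_one
  have h3 := mul_le_mul_of_nonneg_right hRa (norm_nonneg (a - b))
  rw [mul_assoc]
  linarith

lemma lipschitz_transport_radial {R : ℝ} (hR : 0 < R) :
    LipschitzWith (Real.toNNReal (embConst * (R + R) * 2)) fun a => -transport (radial R a) := by
  refine LipschitzWith.of_dist_le_mul fun a b => ?_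
  have hE := embConst_nonneg
  rw [dist_eq_norm, dist_eq_norm, Real.coe_toNNReal _ (by positivity), neg_sub_neg, norm_sub_rev]
  refine (norm_transport_sub_le _ _).trans ?_
  rw [mul_assoc _ 2]
  gcongr
  · exact norm_radial_le hR a
  · exact norm_radial_le hR b
  · exact norm_radial_sub_le hR a b

/-- `a = (1 - Δ) u` where `u` is a mild solution on `[0, T]`, with `u(0) = (1 - Δ)⁻¹ a₀`, of
`u_t = P u - θ(t) u uₓ`; here `P` has the symbol `p`, and the damping factor `θ` has values
in `[0, 1]`. -/
structure IsDampedMild (p : Freq → ℝ) (T : ℝ) (a₀ : L2) (θ : ℝ → ℝ) (a : ℝ → L2) : Prop where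
  continuous : Continuous a
  continuous_damping : Continuous θ
  damping_nonneg : ∀ t, 0 ≤ θ t
  damping_le_one : ∀ t, θ t ≤ 1
  eq : ∀ t ∈ Icc 0 T, a t = mult (semigroupSym p t) a₀ +
    ∫ s in (0 : ℝ)..t, mult (kernelSym p s) (-(θ (t - s) • transport (a (t - s))))

/-- The equation truncated outside the ball of radius `R` of `H²(𝕋²)` has a solution on `[0, T]`;
the truncation is a damping of the transport term. -/
lemma exists_isDampedMild {p : Freq → ℝ} {c C B : ℝ} (h : IsParabolic p c C B) {T : ℝ}
    (hT : 0 ≤ T) (a₀ : L2) {R : ℝ} (hR : 0 < R) :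
    ∃ θ a, IsDampedMild p T a₀ θ a ∧ ∀ t, ‖a t‖ ≤ R → θ t = 1 := by
  obtain ⟨a, ha, hEq⟩ := (h.volterraKernel T).exists_solution hT (lipschitz_transport_radial hR)
    (h.continuous_semigroup a₀)
  have hm : ∀ t, 0 < max R ‖a t‖ := fun t => hR.trans_le (le_max_left _ _)
  refine ⟨fun t => (R / max R ‖a t‖) ^ 2, a, ⟨ha, ?_, fun t => by positivity, fun t => ?_,
    fun t ht => ?_⟩, fun t ht => ?_⟩
  · have h1 : Continuous fun t => max R ‖a t‖ := continuous_const.max ha.norm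
    exact (continuous_const.div h1 fun t => (hm t).ne').pow 2
  · have := hm t
    exact pow_le_one₀ (by positivity) ((div_le_one this).2 (le_max_left _ _))
  · rw [hEq t ht, max_eq_left ht.1]
    simp only [radial, transport_smul]
  · beta_reduce
    rw [max_eq_left ht, div_self hR.ne', one_pow]

namespace IsDampedMild

variable {p : Freq → ℝ} {c C B T : ℝ} {a₀ : L2} {θ : ℝ → ℝ} {a : ℝ → L2}

lemma continuous_forcing (ha : IsDampedMild p T a₀ θ a) :
    Continuous fun t => -(θ t • transport (a t)) :=
  (ha.continuous_damping.smul (continuous_transport.comp ha.continuous)).neg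

lemma norm_forcing_le (ha : IsDampedMild p T a₀ θ a) (t : ℝ) :
    ‖-(θ t • transport (a t))‖ ≤ ‖transport (a t)‖ := by
  rw [norm_neg, norm_smul, Real.norm_of_nonneg (ha.damping_nonneg t)]
  exact mul_le_of_le_one_left (norm_nonneg _) (ha.damping_le_one t)

/-- Duhamel's formula for the Fourier coefficients. -/
lemma coeff_eq (h : IsParabolic p c C B) (ha : IsDampedMild p T a₀ θ a) {t : ℝ}
    (ht : t ∈ Icc 0 T) (ξ : Freq) : coeff (bessel (a t)) ξ =
      (Real.exp (t * p ξ) : ℝ) * coeff (bessel a₀) ξ +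
        ∫ s in (0 : ℝ)..t, (Real.exp ((t - s) * p ξ) : ℝ) *
          coeff (-(θ s • transport (a s))) ξ := by
  have hint : IntervalIntegrable (fun s => mult (kernelSym p s)
      (-(θ (t - s) • transport (a (t - s))))) volume 0 t := by
    rw [intervalIntegrable_iff_integrableOn_Ioc_of_le ht.1]
    exact ((h.volterraKernel T).integrable_conv
      (f := fun s => -(θ (t - s) • transport (a (t - s))))
      (ha.continuous_forcing.comp (continuous_const.sub continuous_id))).mono_set
        (Ioc_subset_Ioc_right ht.2)
  have hw : ((weight ξ : ℝ) : ℂ) ≠ 0 := by exact_mod_cast (weight_pos ξ).ne'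
  rw [coeff_bessel, coeff_bessel, ha.eq t ht, coeff_add,
    coeff_mult (h.conjSymm_semigroupSym t) (h.norm_semigroupSym_le ht.1 ht.2), mul_add]
  congr 1
  · rw [semigroupSym]; ring
  rw [← coeffL_apply, ← ContinuousLinearMap.intervalIntegral_comp_comm _ hint,
    ← intervalIntegral.integral_const_mul]
  have hsub := intervalIntegral.integral_comp_sub_left (a := 0) (b := t)
    (fun s => ((Real.exp ((t - s) * p ξ) : ℝ) : ℂ) * coeff (-(θ s • transport (a s))) ξ) t
  simp only [sub_self, sub_zero, sub_sub_cancel] at hsub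
  rw [← hsub]
  rw [intervalIntegral.integral_of_le ht.1, intervalIntegral.integral_of_le ht.1]
  refine setIntegral_congr_fun measurableSet_Ioc fun s hs => ?_
  rw [coeffL_apply, coeff_mult (h.conjSymm_kernelSym s)
    (h.norm_kernelSym_le hs.1 (hs.2.trans ht.2)), kernelSym, besselSym]
  push_cast
  field_simp

end IsDampedMild

/-! ### Scalar differential equations in integrated form -/

/-- Duhamel's formula solves the scalar equation `y' = p y + f`. -/
lemma eq_add_integral_of_duhamel {p T : ℝ} {f y : ℝ → ℂ} {y₀ : ℂ} (hf : Continuous f)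
    (hy : ∀ t ∈ Icc 0 T, y t = (Real.exp (t * p) : ℝ) * y₀ +
      ∫ s in (0 : ℝ)..t, (Real.exp ((t - s) * p) : ℝ) * f s) :
    ∀ t ∈ Icc 0 T, y t = y₀ + ∫ s in (0 : ℝ)..t, (p * y s + f s) := by
  set Y : ℝ → ℂ := fun t => (Real.exp (t * p) : ℝ) *
    (y₀ + ∫ s in (0 : ℝ)..t, (Real.exp (-(s * p)) : ℝ) * f s) with hY
  have hc : Continuous fun s : ℝ => ((Real.exp (-(s * p)) : ℝ) : ℂ) * f s := by fun_prop
  have hyY : ∀ t ∈ Icc 0 T, y t = Y t := fun t ht => by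
    rw [hy t ht, hY]
    beta_reduce
    rw [mul_add, ← intervalIntegral.integral_const_mul]
    congr 2 with s
    rw [sub_mul, sub_eq_add_neg, Real.exp_add]
    push_cast; ring
  have hexp : ∀ t : ℝ, HasDerivAt (fun t : ℝ => ((Real.exp (t * p) : ℝ) : ℂ))
      ((Real.exp (t * p) * p : ℝ) : ℂ) t := fun t =>
    ((Real.hasDerivAt_exp _).comp t (hasDerivAt_mul_const p)).ofReal_comp
  have hder : ∀ t, HasDerivAt Y (p * Y t + f t) t := fun t => by
    have h1 : HasDerivAt (fun t => y₀ + ∫ s in (0 : ℝ)..t, (Real.exp (-(s * p)) : ℝ) * f s)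
        ((Real.exp (-(t * p)) : ℝ) * f t) t :=
      (intervalIntegral.integral_hasDerivAt_right (hc.intervalIntegrable 0 t)
        (hc.stronglyMeasurableAtFilter _ _) hc.continuousAt).const_add y₀
    have h2 := (hexp t).mul h1
    refine HasDerivAt.congr_deriv (f := Y) h2 ?_
    have h3 : ((Real.exp (t * p) : ℝ) : ℂ) * ((Real.exp (-(t * p)) : ℝ) : ℂ) = 1 := by
      rw [← Complex.ofReal_mul, ← Real.exp_add]; simp
    simp only [hY]
    push_cast at h3 ⊢
    linear_combination f t * h3
  have hYc : Continuous Y := continuous_iff_continuousAt.2 fun t => (hder t).continuousAt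
  intro t ht
  have h4 := intervalIntegral.integral_eq_sub_of_hasDerivAt (a := 0) (b := t)
    (fun s _ => hder s) (Continuous.intervalIntegrable (by fun_prop) 0 t)
  have h5 : ∫ s in (0 : ℝ)..t, (p * y s + f s) = ∫ s in (0 : ℝ)..t, (p * Y s + f s) := by
    refine intervalIntegral.integral_congr fun s hs => ?_
    rw [uIcc_of_le ht.1] at hs
    rw [hyY s ⟨hs.1, hs.2.trans ht.2⟩]
  rw [h5, h4, hyY t ht]
  simp [hY]

lemma continuousOn_primitive_Icc {E : Type*} [NormedAddCommGroup E] [NormedSpace ℝ E] {T : ℝ}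
    (hT : 0 ≤ T) {g : ℝ → E} (hg : ContinuousOn g (Icc 0 T)) :
    ContinuousOn (fun t => ∫ s in (0 : ℝ)..t, g s) (Icc 0 T) := by
  rw [← uIcc_of_le hT] at hg ⊢
  exact intervalIntegral.continuousOn_primitive_interval' (μ := volume) hg.intervalIntegrable
    left_mem_uIcc

lemma hasDerivAt_primitive_Icc {E : Type*} [NormedAddCommGroup E] [NormedSpace ℝ E]
    [CompleteSpace E] {T : ℝ} {g : ℝ → E} (hg : ContinuousOn g (Icc 0 T)) {t : ℝ}
    (ht : t ∈ Ioo 0 T) : HasDerivAt (fun t => ∫ s in (0 : ℝ)..t, g s) (g t) t := by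
  refine intervalIntegral.integral_hasDerivAt_right ?_ ?_
    ((hg t ⟨ht.1.le, ht.2.le⟩).continuousAt (Icc_mem_nhds ht.1 ht.2))
  · refine (hg.mono ?_).intervalIntegrable
    rw [uIcc_of_le ht.1.le]
    exact Icc_subset_Icc_right ht.2.le
  · exact (hg.mono Ioo_subset_Icc_self).stronglyMeasurableAtFilter isOpen_Ioo t ht

/-- The balance of the squared modulus of a primitive. -/
lemma norm_sq_eq_add_integral {T : ℝ} {y g : ℝ → ℂ} {y₀ : ℂ} (hg : ContinuousOn g (Icc 0 T))
    (hy : ∀ t ∈ Icc 0 T, y t = y₀ + ∫ s in (0 : ℝ)..t, g s) :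
    ∀ t ∈ Icc 0 T, ‖y t‖ ^ 2 = ‖y₀‖ ^ 2 + ∫ s in (0 : ℝ)..t, 2 * inner ℝ (y s) (g s) := by
  intro t ht
  have h0T : (0 : ℝ) ≤ T := ht.1.trans ht.2
  have hyc : ContinuousOn y (Icc 0 T) :=
    ((continuousOn_primitive_Icc h0T hg).const_add y₀).congr hy
  have hsub : Icc 0 t ⊆ Icc 0 T := Icc_subset_Icc_right ht.2
  have hder : ∀ s ∈ Ioo 0 t, HasDerivAt (fun s => ‖y s‖ ^ 2) (2 * inner ℝ (y s) (g s)) s := by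
    intro s hs
    have hsT : s ∈ Ioo 0 T := ⟨hs.1, hs.2.trans_le ht.2⟩
    have h2 : HasDerivAt y (g s) s :=
      ((hasDerivAt_primitive_Icc hg hsT).const_add y₀).congr_of_eventuallyEq
        (by filter_upwards [Icc_mem_nhds hsT.1 hsT.2] with r hr using hy r hr)
    exact h2.norm_sq
  have hcont : ContinuousOn (fun s => 2 * inner ℝ (y s) (g s)) (Icc 0 t) :=
    continuousOn_const.mul ((hyc.mono hsub).inner (hg.mono hsub))
  have h3 := intervalIntegral.integral_eq_sub_of_hasDerivAt_of_le ht.1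
    (f := fun s => ‖y s‖ ^ 2) ((hyc.mono hsub).norm.pow 2) hder (by
      refine ContinuousOn.intervalIntegrable ?_
      rwa [uIcc_of_le ht.1])
  have h4 : y 0 = y₀ := by simpa using hy 0 ⟨le_rfl, h0T⟩
  rw [h3, h4]; ring

/-- Grönwall's inequality in integrated form. -/
lemma le_mul_exp_of_le_add_integral {T A K : ℝ} {h : ℝ → ℝ} (hc : ContinuousOn h (Icc 0 T))
    (hK : 0 ≤ K) (hle : ∀ t ∈ Icc 0 T, h t ≤ A + K * ∫ s in (0 : ℝ)..t, h s) :
    ∀ t ∈ Icc 0 T, h t ≤ A * Real.exp (K * t) := by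
  intro t ht
  have h0T : (0 : ℝ) ≤ T := ht.1.trans ht.2
  have hexp : ∀ s, HasDerivAt (fun s => Real.exp (-(K * s))) (Real.exp (-(K * s)) * -K) s :=
    fun s => by
      have := (Real.hasDerivAt_exp (-(K * s))).comp s ((hasDerivAt_const_mul K).neg)
      exact this
  have hder : ∀ s ∈ Ioo 0 T, HasDerivAt
      (fun s => Real.exp (-(K * s)) * (A + K * ∫ r in (0 : ℝ)..s, h r))
      (Real.exp (-(K * s)) * -K * (A + K * ∫ r in (0 : ℝ)..s, h r) +
        Real.exp (-(K * s)) * (K * h s)) s := fun s hs =>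
    (hexp s).mul (((hasDerivAt_primitive_Icc hc hs).const_mul K).const_add A)
  have hanti : AntitoneOn (fun s => Real.exp (-(K * s)) * (A + K * ∫ r in (0 : ℝ)..s, h r))
      (Icc 0 T) := by
    refine antitoneOn_of_deriv_nonpos (convex_Icc 0 T) ?_ ?_ ?_
    · exact ContinuousOn.mul (by fun_prop)
        (((continuousOn_primitive_Icc h0T hc).const_mul K).const_add A)
    · rw [interior_Icc]
      exact fun s hs => (hder s hs).differentiableAt.differentiableWithinAt
    · rw [interior_Icc]
      intro s hs
      rw [(hder s hs).deriv]
      have h1 := hle s ⟨hs.1.le, hs.2.le⟩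
      have h2 := mul_nonneg (Real.exp_pos (-(K * s))).le hK
      nlinarith
  have h1 := hanti ⟨le_rfl, h0T⟩ ht ht.1
  simp only [mul_zero, neg_zero, Real.exp_zero, intervalIntegral.integral_same, add_zero,
    one_mul] at h1
  calc h t ≤ A + K * ∫ s in (0 : ℝ)..t, h s := hle t ht
    _ = Real.exp (-(K * t)) * (A + K * ∫ s in (0 : ℝ)..t, h s) * Real.exp (K * t) := by
        have : Real.exp (-(K * t)) * Real.exp (K * t) = 1 := by rw [← Real.exp_add]; simp
        linear_combination (-(A + K * ∫ s in (0 : ℝ)..t, h s)) * this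
    _ ≤ _ := by gcongr

/-! ### A priori bounds -/

lemma inner_ofReal_mul_self (r : ℝ) (z : ℂ) : inner ℝ z ((r : ℂ) * z) = r * ‖z‖ ^ 2 := by
  rw [← Complex.real_smul, inner_smul_right, real_inner_self_eq_norm_sq]

lemma integral_exp_decay_le {l t : ℝ} (hl : 0 < l) :
    ∫ s in (0 : ℝ)..t, Real.exp (-(l * (t - s))) ≤ l⁻¹ := by
  have hder : ∀ s ∈ uIcc 0 t, HasDerivAt (fun s => l⁻¹ * Real.exp (-(l * (t - s))))
      (Real.exp (-(l * (t - s)))) s := fun s _ => by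
    have h1 : HasDerivAt (fun s => -(l * (t - s))) l s := by
      have := (((hasDerivAt_id s).const_sub t).const_mul l).neg
      exact this.congr_deriv (by ring)
    refine (((Real.hasDerivAt_exp _).comp s h1).const_mul l⁻¹).congr_deriv ?_
    field_simp
  rw [intervalIntegral.integral_eq_sub_of_hasDerivAt hder
    (Continuous.intervalIntegrable (by fun_prop) _ _)]
  have := mul_pos (inv_pos.2 hl) (Real.exp_pos (-(l * (t - 0))))
  simp only [sub_self, mul_zero, neg_zero, Real.exp_zero, mul_one]
  linarith

namespace IsDampedMild

variable {p : Freq → ℝ} {c C B T : ℝ} {a₀ : L2} {θ : ℝ → ℝ} {a : ℝ → L2}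

lemma continuous_coeff (ha : IsDampedMild p T a₀ θ a) (ξ : Freq) :
    Continuous fun t => coeff (bessel (a t)) ξ :=
  (KSTorus.continuous_coeff ξ).comp (continuous_bessel.comp ha.continuous)

lemma continuous_coeff_forcing (ha : IsDampedMild p T a₀ θ a) (ξ : Freq) :
    Continuous fun t => coeff (-(θ t • transport (a t))) ξ :=
  (KSTorus.continuous_coeff ξ).comp ha.continuous_forcing

lemma coeff_eq_add_integral (h : IsParabolic p c C B) (ha : IsDampedMild p T a₀ θ a) (ξ : Freq) :
    ∀ t ∈ Icc 0 T, coeff (bessel (a t)) ξ = coeff (bessel a₀) ξ + ∫ s in (0 : ℝ)..t,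
      (p ξ * coeff (bessel (a s)) ξ + coeff (-(θ s • transport (a s))) ξ) :=
  eq_add_integral_of_duhamel (ha.continuous_coeff_forcing ξ) fun _ ht => ha.coeff_eq h ht ξ

lemma norm_sq_coeff_eq (h : IsParabolic p c C B) (ha : IsDampedMild p T a₀ θ a) (ξ : Freq)
    {t : ℝ} (ht : t ∈ Icc 0 T) : ‖coeff (bessel (a t)) ξ‖ ^ 2 = ‖coeff (bessel a₀) ξ‖ ^ 2 +
      ∫ s in (0 : ℝ)..t, (2 * p ξ * ‖coeff (bessel (a s)) ξ‖ ^ 2 +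
        2 * inner ℝ (coeff (bessel (a s)) ξ) (coeff (-(θ s • transport (a s))) ξ)) := by
  have hc : Continuous fun s => (p ξ : ℂ) * coeff (bessel (a s)) ξ +
      coeff (-(θ s • transport (a s))) ξ :=
    ((ha.continuous_coeff ξ).const_mul _).add (ha.continuous_coeff_forcing ξ)
  rw [norm_sq_eq_add_integral hc.continuousOn (ha.coeff_eq_add_integral h ξ) t ht]
  congr 2
  ext s
  rw [inner_add_right, inner_ofReal_mul_self]
  ring

/-- The `L²` bound, in which neither the transport term nor its truncation contributes. -/
lemma norm_sq_bessel_le (h : IsParabolic p c C B) (ha : IsDampedMild p T a₀ θ a) {t : ℝ}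
    (ht : t ∈ Icc 0 T) : ‖bessel (a t)‖ ^ 2 ≤ ‖bessel a₀‖ ^ 2 * Real.exp (2 * C * T) := by
  set u : ℝ → L2 := fun t => bessel (a t) with hu
  set f : ℝ → L2 := fun t => -(θ t • transport (a t)) with hf
  have huc : Continuous u := continuous_bessel.comp ha.continuous
  have hfc : Continuous f := ha.continuous_forcing
  have horth : ∀ s, inner ℝ (u s) (f s) = 0 := fun s => by
    simp only [hu, hf]
    rw [inner_neg_right, inner_smul_right, inner_bessel_transport]; simp
  have hC := h.C_nonneg
  set κ : ℝ := ((2 * Real.pi) ^ 2)⁻¹ with hκ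
  have hκ0 : 0 < κ := by have := Real.pi_pos; positivity
  have key : ∀ t ∈ Icc 0 T, ‖u t‖ ^ 2 ≤ ‖bessel a₀‖ ^ 2 + 2 * C * ∫ s in (0 : ℝ)..t, ‖u s‖ ^ 2 := by
    intro t ht
    -- The balances of finitely many modes are added up, and their number tends to infinity.
    have h1 : ∀ F : Finset Freq, ∑ ξ ∈ F, ‖coeff (u t) ξ‖ ^ 2 ≤
        ∑ ξ ∈ F, ‖coeff (bessel a₀) ξ‖ ^ 2 + ∫ s in (0 : ℝ)..t,
          (2 * C * ∑ ξ ∈ F, ‖coeff (u s) ξ‖ ^ 2 +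
            2 * ∑ ξ ∈ F, inner ℝ (coeff (u s) ξ) (coeff (f s) ξ)) := by
      intro F
      have hcu := ha.continuous_coeff
      have hcf := ha.continuous_coeff_forcing
      have e : ∀ s, 2 * C * ∑ ξ ∈ F, ‖coeff (u s) ξ‖ ^ 2 +
          2 * ∑ ξ ∈ F, inner ℝ (coeff (u s) ξ) (coeff (f s) ξ) =
          ∑ ξ ∈ F, (2 * C * ‖coeff (u s) ξ‖ ^ 2 +
            2 * inner ℝ (coeff (u s) ξ) (coeff (f s) ξ)) := fun s => by
        rw [Finset.mul_sum, Finset.mul_sum, ← Finset.sum_add_distrib]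
      simp_rw [e]
      rw [intervalIntegral.integral_finsetSum fun ξ _ => Continuous.intervalIntegrable
        (by have := hcu ξ; have := hcf ξ; fun_prop) _ _, ← Finset.sum_add_distrib]
      refine Finset.sum_le_sum fun ξ _ => ?_
      rw [ha.norm_sq_coeff_eq h ξ ht]
      refine add_le_add_right (intervalIntegral.integral_mono_on ht.1 ?_ ?_ fun s _ => ?_) _
      · exact Continuous.intervalIntegrable (by have := hcu ξ; have := hcf ξ; fun_prop) _ _
      · exact Continuous.intervalIntegrable (by have := hcu ξ; have := hcf ξ; fun_prop) _ _
      · have := h.le_C ξ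
        gcongr
    have htend : ∀ f : L2, Tendsto (fun F => ∑ ξ ∈ F, ‖coeff f ξ‖ ^ 2) atTop
        (𝓝 (κ * ‖f‖ ^ 2)) := hasSum_sq_norm_coeff
    have h2 : Tendsto (fun F : Finset Freq => ∑ ξ ∈ F, ‖coeff (bessel a₀) ξ‖ ^ 2 +
        ∫ s in (0 : ℝ)..t, (2 * C * ∑ ξ ∈ F, ‖coeff (u s) ξ‖ ^ 2 +
            2 * ∑ ξ ∈ F, inner ℝ (coeff (u s) ξ) (coeff (f s) ξ))) atTop
        (𝓝 (κ * ‖bessel a₀‖ ^ 2 + ∫ s in (0 : ℝ)..t, (2 * C * (κ * ‖u s‖ ^ 2) + 2 * 0))) := by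
      refine (htend _).add ?_
      refine intervalIntegral.tendsto_integral_filter_of_dominated_convergence
        (fun s => 2 * C * ‖u s‖ ^ 2 + 2 * (‖u s‖ ^ 2 + ‖f s‖ ^ 2)) ?_ ?_ ?_ ?_
      · refine Eventually.of_forall fun F => Continuous.aestronglyMeasurable ?_
        refine Continuous.add (continuous_const.mul ?_) (continuous_const.mul ?_)
        · exact continuous_finsetSum _ fun ξ _ => (ha.continuous_coeff ξ).norm.pow 2
        · exact continuous_finsetSum _ fun ξ _ =>
            (ha.continuous_coeff ξ).inner (ha.continuous_coeff_forcing ξ)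
      · refine Eventually.of_forall fun F => Eventually.of_forall fun s _ => ?_
        refine (norm_add_le _ _).trans (add_le_add ?_ ?_)
        · rw [Real.norm_of_nonneg (by positivity)]
          gcongr
          exact sum_sq_norm_coeff_le _ F
        · rw [norm_mul, Real.norm_ofNat]
          refine mul_le_mul_of_nonneg_left ?_ zero_le_two
          refine (norm_sum_le _ _).trans ?_
          refine le_trans ?_ (add_le_add (sum_sq_norm_coeff_le (u s) F)
            (sum_sq_norm_coeff_le (f s) F))
          rw [← Finset.sum_add_distrib]
          refine Finset.sum_le_sum fun ξ _ => ?_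
          have := norm_inner_le_norm (𝕜 := ℝ) (coeff (u s) ξ) (coeff (f s) ξ)
          nlinarith [sq_nonneg (‖coeff (u s) ξ‖ - ‖coeff (f s) ξ‖),
            sq_nonneg (‖coeff (u s) ξ‖ + ‖coeff (f s) ξ‖)]
      · exact Continuous.intervalIntegrable (by fun_prop) _ _
      · refine Eventually.of_forall fun s _ => ?_
        refine ((htend (u s)).const_mul _).add (Tendsto.const_mul _ ?_)
        have h3 := hasSum_re_inner_coeff (u s) (f s)
        rw [horth, mul_zero] at h3
        exact h3
    have h4 := le_of_tendsto_of_tendsto' (htend (u t)) h2 h1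
    have e : ∫ s in (0 : ℝ)..t, (2 * C * (κ * ‖u s‖ ^ 2) + 2 * 0) =
        κ * (2 * C * ∫ s in (0 : ℝ)..t, ‖u s‖ ^ 2) := by
      rw [← intervalIntegral.integral_const_mul, ← intervalIntegral.integral_const_mul]
      congr 1 with s
      ring
    rw [e, ← mul_add] at h4
    exact le_of_mul_le_mul_left h4 hκ0
  refine (le_mul_exp_of_le_add_integral (huc.norm.pow 2).continuousOn (by positivity) key t ht
    ).trans ?_
  have := ht.2
  gcongr

lemma norm_coeff_forcing_le (h : IsParabolic p c C B) (ha : IsDampedMild p T a₀ θ a) {t : ℝ}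
    (ht : t ∈ Icc 0 T) (ξ : Freq) : ‖coeff (-(θ t • transport (a t))) ξ‖ ≤
      |(ξ 0 : ℝ)| * (‖bessel a₀‖ ^ 2 * Real.exp (2 * C * T)) := by
  rw [coeff_neg, norm_neg, coeff_smul, norm_mul, Complex.norm_real,
    Real.norm_of_nonneg (ha.damping_nonneg t)]
  refine (mul_le_of_le_one_left (norm_nonneg _) (ha.damping_le_one t)).trans ?_
  refine (norm_coeff_transport_le (a t) ξ).trans ?_
  gcongr
  exact ha.norm_sq_bessel_le h ht

/-- The decay of the Fourier coefficients that follows from the `L²` bound: `u²` is bounded in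
`L¹`, hence its Fourier coefficients are bounded, and the semigroup gains four derivatives on the
derivative of `u²`. -/
lemma norm_coeff_le (h : IsParabolic p c C B) (ha : IsDampedMild p T a₀ θ a) {t : ℝ}
    (ht : t ∈ Icc 0 T) (ξ : Freq) : ‖coeff (bessel (a t)) ξ‖ ≤
      Real.exp (C * T) * ‖coeff (bessel a₀) ξ‖ +
        Real.exp (C * T) * (‖bessel a₀‖ ^ 2 * Real.exp (2 * C * T)) * c⁻¹ *
          (|(ξ 0 : ℝ)| * (weight ξ)⁻¹ ^ 2) := by
  set M := ‖bessel a₀‖ ^ 2 * Real.exp (2 * C * T) with hM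
  have hw := weight_pos ξ
  have hc := h.c_pos
  have hl : 0 < c * weight ξ ^ 2 := by positivity
  rw [ha.coeff_eq h ht ξ]
  refine (norm_add_le _ _).trans (add_le_add ?_ ?_)
  · rw [norm_mul, Complex.norm_real, Real.norm_of_nonneg (Real.exp_pos _).le]
    exact mul_le_mul_of_nonneg_right (h.exp_le ht.1 ht.2 ξ) (norm_nonneg _)
  have hexp : ∀ s ∈ Ioc 0 t, Real.exp ((t - s) * p ξ) ≤
      Real.exp (C * T) * Real.exp (-(c * weight ξ ^ 2 * (t - s))) := by
    intro s hs
    rw [← Real.exp_add]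
    refine Real.exp_le_exp.2 ?_
    have h1 := mul_le_mul_of_nonneg_left (h.le ξ) (sub_nonneg.2 hs.2)
    have h2 := mul_le_mul_of_nonneg_left (show t - s ≤ T by linarith [hs.1, ht.2]) h.C_nonneg
    nlinarith
  refine (intervalIntegral.norm_integral_le_of_norm_le (g := fun s => Real.exp (C * T) *
    (|(ξ 0 : ℝ)| * M) * Real.exp (-(c * weight ξ ^ 2 * (t - s)))) ht.1
    (Eventually.of_forall fun s hs => ?_)
    (Continuous.intervalIntegrable (by fun_prop) _ _)).trans ?_
  · rw [norm_mul, Complex.norm_real, Real.norm_of_nonneg (Real.exp_pos _).le]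
    have h1 := ha.norm_coeff_forcing_le h (t := s) ⟨hs.1.le, hs.2.trans ht.2⟩ ξ
    calc _ ≤ Real.exp (C * T) * Real.exp (-(c * weight ξ ^ 2 * (t - s))) * (|(ξ 0 : ℝ)| * M) := by
          gcongr
          exact hexp s hs
      _ = _ := by ring
  · rw [intervalIntegral.integral_const_mul]
    refine (mul_le_mul_of_nonneg_left (integral_exp_decay_le hl) (by positivity)).trans_eq ?_
    rw [mul_inv, inv_pow]
    ring

end IsDampedMild

/-- A bound in `H²(𝕋²)` that does not depend on the truncation. -/
theorem exists_bound_of_isDampedMild {p : Freq → ℝ} {c C B : ℝ} (h : IsParabolic p c C B) (T : ℝ)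
    (a₀ : L2) : ∃ M, 0 < M ∧ ∀ θ a, IsDampedMild p T a₀ θ a → ∀ t ∈ Icc 0 T, ‖a t‖ ≤ M := by
  set E := Real.exp (C * T) with hE
  set B₁ := E * (‖bessel a₀‖ ^ 2 * Real.exp (2 * C * T)) * c⁻¹ with hB
  have hE0 : 0 ≤ E := (Real.exp_pos _).le
  have hc := h.c_pos
  have hB0 : 0 ≤ B₁ := by positivity
  -- `b` dominates the Fourier coefficients of the solution, and `d` the squares of those of its
  -- `x`-derivative; their sums bound the solution in `L^∞` and the derivative in `L²`.
  set b : Freq → ℝ := fun ξ => E * ‖coeff (bessel a₀) ξ‖ + B₁ * (|(ξ 0 : ℝ)| * (weight ξ)⁻¹ ^ 2)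
    with hb
  have hbs : Summable b := ((summable_norm_coeff_bessel_and_le a₀).1.mul_left E).add
    (summable_abs_mul_inv_weight_sq.mul_left B₁)
  set d : Freq → ℝ := fun ξ => 2 * E ^ 2 * ‖coeff a₀ ξ‖ ^ 2 + 2 * B₁ ^ 2 * (weight ξ)⁻¹ ^ 2 with hd
  have hds : Summable d := ((summable_sq_norm_coeff a₀).mul_left _).add
    (summable_inv_weight_sq.mul_left _)
  have hbd : ∀ ξ, (|(ξ 0 : ℝ)| * b ξ) ^ 2 ≤ d ξ := fun ξ => by
    have hw := weight_pos ξ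
    have h1 : |(ξ 0 : ℝ)| * ‖coeff (bessel a₀) ξ‖ ≤ ‖coeff a₀ ξ‖ := by
      rw [← weight_mul_norm_coeff_bessel a₀ ξ]
      gcongr
      exact abs_le_weight ξ
    have h2 : |(ξ 0 : ℝ)| * (|(ξ 0 : ℝ)| * (weight ξ)⁻¹ ^ 2) ≤ (weight ξ)⁻¹ := by
      rw [← mul_assoc, abs_mul_abs_self, inv_pow, ← div_eq_mul_inv, div_le_iff₀ (by positivity),
        ← sq, sq (weight ξ), inv_mul_cancel_left₀ hw.ne']
      exact sq_le_weight ξ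
    have h3 : |(ξ 0 : ℝ)| * b ξ ≤ E * ‖coeff a₀ ξ‖ + B₁ * (weight ξ)⁻¹ := by
      have h4 := mul_le_mul_of_nonneg_left h1 hE0
      have h5 := mul_le_mul_of_nonneg_left h2 hB0
      simp only [hb]
      nlinarith
    have h6 : 0 ≤ |(ξ 0 : ℝ)| * b ξ := by positivity
    refine (pow_le_pow_left₀ h6 h3 2).trans ?_
    simp only [hd]
    nlinarith [sq_nonneg (E * ‖coeff a₀ ξ‖ - B₁ * (weight ξ)⁻¹)]
  set S := ∑' ξ, b ξ with hS
  set D := √((2 * Real.pi) ^ 2 * ∑' ξ, d ξ) with hD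
  have hS0 : 0 ≤ S := tsum_nonneg fun ξ => by have := weight_pos ξ; positivity
  set I := ∫ s in Ioc 0 T, kernelBound c C T s with hI
  have hI0 : 0 ≤ I := setIntegral_nonneg measurableSet_Ioc fun s _ => kernelBound_nonneg c C T s
  refine ⟨E * ‖a₀‖ + I * (S * D) + 1, by positivity, fun θ a ha t ht => ?_⟩
  have hcoeff : ∀ s ∈ Icc 0 T, ∀ ξ, ‖coeff (bessel (a s)) ξ‖ ≤ b ξ := fun s hs ξ =>
    ha.norm_coeff_le h hs ξ
  have hsup : ∀ s ∈ Icc 0 T, ∀ᵐ p, ‖bessel (a s) p‖ ≤ S := fun s hs => by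
    have h1 := hbs.of_nonneg_of_le (fun _ => norm_nonneg _) (hcoeff s hs)
    filter_upwards [ae_norm_le_tsum_norm_coeff h1] with p hp
    exact hp.trans (h1.tsum_le_tsum (hcoeff s hs) hbs)
  have hdx : ∀ s ∈ Icc 0 T, ‖dxBessel (a s)‖ ≤ D := fun s hs => by
    refine Real.le_sqrt_of_sq_le ?_
    rw [norm_sq_eq_tsum]
    refine mul_le_mul_of_nonneg_left ?_ (by positivity)
    refine (summable_sq_norm_coeff _).tsum_le_tsum (fun ξ => ?_) hds
    refine le_trans ?_ (hbd ξ)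
    rw [hasSymbol_symDx_bessel (a s) ξ, norm_mul, norm_symDx]
    gcongr
    exact hcoeff s hs ξ
  have htr : ∀ s ∈ Icc 0 T, ‖-(θ s • transport (a s))‖ ≤ S * D := fun s hs =>
    (ha.norm_forcing_le s).trans ((norm_mulL2_le (hsup s hs)).trans (by gcongr; exact hdx s hs))
  rw [ha.eq t ht]
  refine (norm_add_le _ _).trans ?_
  have h1 : ‖mult (semigroupSym p t) a₀‖ ≤ E * ‖a₀‖ :=
    norm_mult_le (h.conjSymm_semigroupSym t) (h.norm_semigroupSym_le ht.1 ht.2) a₀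
  have h2 : ‖∫ s in (0 : ℝ)..t, mult (kernelSym p s) (-(θ (t - s) • transport (a (t - s))))‖ ≤
      I * (S * D) := by
    rw [intervalIntegral.integral_of_le ht.1, hI, ← integral_mul_const]
    refine (norm_integral_le_of_norm_le (((integrableOn_kernelBound c C T).mono_set
      (Ioc_subset_Ioc_right ht.2)).mul_const (S * D)) ?_).trans ?_
    · filter_upwards [ae_restrict_mem measurableSet_Ioc] with s hs
      have h3 := (h.volterraKernel T).norm_le ⟨hs.1, hs.2.trans ht.2⟩
        (-(θ (t - s) • transport (a (t - s))))
      refine h3.trans (mul_le_mul_of_nonneg_left (htr _ ⟨?_, ?_⟩) (kernelBound_nonneg c C T s))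
      · linarith [hs.2]
      · linarith [hs.1, ht.2]
    · refine setIntegral_mono_set ((integrableOn_kernelBound c C T).mul_const _) ?_
        (Ioc_subset_Ioc_right ht.2).eventuallyLE
      exact Eventually.of_forall fun s => mul_nonneg (kernelBound_nonneg c C T s) (by positivity)
  linarith

/-- The equation without truncation has a mild solution on `[0, T]`. -/
theorem exists_isDampedMild_eq_one {p : Freq → ℝ} {c C B : ℝ} (h : IsParabolic p c C B) {T : ℝ}
    (hT : 0 ≤ T) (a₀ : L2) :
    ∃ θ a, IsDampedMild p T a₀ θ a ∧ ∀ t ∈ Icc 0 T, θ t = 1 := by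
  obtain ⟨M, hM, hbound⟩ := exists_bound_of_isDampedMild h T a₀
  obtain ⟨θ, a, ha, hθ⟩ := exists_isDampedMild h hT a₀ hM
  exact ⟨θ, a, ha, fun t ht => hθ t (hbound θ a ha t ht)⟩

/-! ### The linear part of the equation -/

/-- The symbol of `-(β - 1) ∂ₓₓ + ∂_yy + δ Λ³ - ε Δ²`. -/
def linSym (β δ ε : ℝ) (ξ : Freq) : ℝ :=
  (β - 1) * (ξ 0 : ℝ) ^ 2 - (ξ 1 : ℝ) ^ 2 + δ * freqNorm ξ ^ 3 - ε * freqNorm ξ ^ 4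

/-- The term `-ε |ξ|⁴` dominates the other ones by Young's inequality. -/
lemma isParabolic_linSym {β δ ε : ℝ} (hβ : 0 < β) (hδ : 0 ≤ δ) (hε : 0 < ε) :
    IsParabolic (linSym β δ ε) (ε / 8) (β ^ 2 / ε + δ ^ 4 / ε ^ 3 + ε / 4)
      (|β - 1| + 1 + δ + ε) where
  even ξ := by simp [linSym, freqNorm_neg]
  c_pos := by positivity
  C_nonneg := by positivity
  le ξ := by
    have hr := freqNorm_nonneg ξ
    have h2 := freqNorm_sq ξ
    unfold linSym weight
    set r := freqNorm ξ
    have hx : (β - 1) * (ξ 0 : ℝ) ^ 2 - (ξ 1 : ℝ) ^ 2 ≤ β * r ^ 2 := by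
      rw [h2]; nlinarith [sq_nonneg (ξ 0 : ℝ), sq_nonneg (ξ 1 : ℝ)]
    have h3 : β * r ^ 2 ≤ ε / 4 * r ^ 4 + β ^ 2 / ε := by
      have : ε / 4 * r ^ 4 + β ^ 2 / ε - β * r ^ 2 = (ε / 2 * r ^ 2 - β) ^ 2 / ε := by
        field_simp; ring
      have h : 0 ≤ (ε / 2 * r ^ 2 - β) ^ 2 / ε := by positivity
      linarith
    have h4 : δ * r ^ 3 ≤ ε / 4 * r ^ 4 + δ ^ 2 / ε * r ^ 2 := by
      have : ε / 4 * r ^ 4 + δ ^ 2 / ε * r ^ 2 - δ * r ^ 3 = (ε / 2 * r - δ) ^ 2 * r ^ 2 / ε := by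
        field_simp; ring
      have h : 0 ≤ (ε / 2 * r - δ) ^ 2 * r ^ 2 / ε := by positivity
      linarith
    have h5 : δ ^ 2 / ε * r ^ 2 ≤ ε / 4 * r ^ 4 + δ ^ 4 / ε ^ 3 := by
      have : ε / 4 * r ^ 4 + δ ^ 4 / ε ^ 3 - δ ^ 2 / ε * r ^ 2 =
          (ε ^ 2 / 2 * r ^ 2 - δ ^ 2) ^ 2 / ε ^ 3 := by
        field_simp; ring
      have h : 0 ≤ (ε ^ 2 / 2 * r ^ 2 - δ ^ 2) ^ 2 / ε ^ 3 := by positivity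
      linarith
    have h6 : (1 + r ^ 2) ^ 2 ≤ 2 + 2 * r ^ 4 := by nlinarith [sq_nonneg (r ^ 2 - 1)]
    nlinarith
  abs_le ξ := by
    have hr := freqNorm_nonneg ξ
    have h2 := freqNorm_sq ξ
    unfold linSym weight
    set r := freqNorm ξ
    have hx : (ξ 0 : ℝ) ^ 2 ≤ (1 + r ^ 2) ^ 2 := by
      rw [h2]; nlinarith [sq_nonneg (ξ 0 : ℝ), sq_nonneg (ξ 1 : ℝ)]
    have hy : (ξ 1 : ℝ) ^ 2 ≤ (1 + r ^ 2) ^ 2 := by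
      rw [h2]; nlinarith [sq_nonneg (ξ 0 : ℝ), sq_nonneg (ξ 1 : ℝ)]
    have h3 : r ^ 3 ≤ (1 + r ^ 2) ^ 2 := by nlinarith [sq_nonneg (r * (r - 1)), sq_nonneg r]
    have h4 : r ^ 4 ≤ (1 + r ^ 2) ^ 2 := by nlinarith [sq_nonneg r]
    calc |(β - 1) * (ξ 0 : ℝ) ^ 2 - (ξ 1 : ℝ) ^ 2 + δ * r ^ 3 - ε * r ^ 4|
        ≤ |(β - 1) * (ξ 0 : ℝ) ^ 2| + |(ξ 1 : ℝ) ^ 2| + |δ * r ^ 3| + |ε * r ^ 4| := by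
          refine (abs_sub _ _).trans (add_le_add_left ((abs_add_le _ _).trans
            (add_le_add_left (abs_sub _ _) _)) _)
      _ = |β - 1| * (ξ 0 : ℝ) ^ 2 + (ξ 1 : ℝ) ^ 2 + δ * r ^ 3 + ε * r ^ 4 := by
          rw [abs_mul, abs_of_nonneg (sq_nonneg (ξ 0 : ℝ)), abs_of_nonneg (sq_nonneg (ξ 1 : ℝ)),
            abs_of_nonneg (show 0 ≤ δ * r ^ 3 by positivity),
            abs_of_nonneg (show 0 ≤ ε * r ^ 4 by positivity)]
      _ ≤ |β - 1| * (1 + r ^ 2) ^ 2 + (1 + r ^ 2) ^ 2 + δ * (1 + r ^ 2) ^ 2 +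
          ε * (1 + r ^ 2) ^ 2 := by gcongr
      _ = _ := by ring

/-- The equation at one instant, as an identity in `L²(𝕋²)`. -/
lemma equation_ae_iff {β δ ε : ℝ} {a v uxx uyy lam bilap : L2} :
    (∀ᵐ p : Torus2, v p + bessel a p * dxBessel a p + (β - 1) * uxx p - uyy p - δ * lam p +
      ε * bilap p = 0) ↔
      v + transport a + (β - 1) • uxx - uyy - δ • lam + ε • bilap = 0 := by
  rw [Lp.eq_zero_iff_ae_eq_zero]
  have h : (v + transport a + (β - 1) • uxx - uyy - δ • lam + ε • bilap : L2) =ᵐ[volume]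
      fun p => v p + bessel a p * dxBessel a p + (β - 1) * uxx p - uyy p - δ * lam p +
        ε * bilap p := by
    filter_upwards [coeFn_transport a, Lp.coeFn_add v (transport a),
      Lp.coeFn_smul (β - 1) uxx, Lp.coeFn_smul δ lam, Lp.coeFn_smul ε bilap,
      Lp.coeFn_add (v + transport a) ((β - 1) • uxx),
      Lp.coeFn_sub (v + transport a + (β - 1) • uxx) uyy,
      Lp.coeFn_sub (v + transport a + (β - 1) • uxx - uyy) (δ • lam),
      Lp.coeFn_add (v + transport a + (β - 1) • uxx - uyy - δ • lam) (ε • bilap)]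
      with p h1 h2 h3 h4 h5 h6 h7 h8 h9
    simp only [h9, h8, h7, h6, h2, Pi.add_apply, Pi.sub_apply, h3, h4, h5, Pi.smul_apply,
      smul_eq_mul, h1]
  exact ⟨fun h' => h.trans h', fun h' => h.symm.trans h'⟩

lemma linSym_eq (β δ ε : ℝ) (ξ : Freq) : ((linSym β δ ε ξ : ℝ) : ℂ) =
    -((β - 1) * symDx ξ ^ 2) + symDy ξ ^ 2 + δ * symLambda ξ ^ 3 -
      ε * (symDx ξ ^ 2 + symDy ξ ^ 2) ^ 2 := by
  have h2 := freqNorm_sq ξ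
  have h4 : freqNorm ξ ^ 4 = ((ξ 0 : ℝ) ^ 2 + (ξ 1 : ℝ) ^ 2) ^ 2 := by rw [← h2]; ring
  rw [linSym, h4]
  simp only [symDx, symDy, symLambda, mul_pow, Complex.I_sq]
  push_cast
  ring

lemma coeff_of_satisfiesPDE {β δ ε : ℝ} {a v : L2} (h : SatisfiesPDE β δ ε (bessel a) v)
    (ξ : Freq) : coeff v ξ =
      linSym β δ ε ξ * coeff (bessel a) ξ - coeff (transport a) ξ := by
  obtain ⟨ux, uxx, uyy, lam, bilap, hux, huxx, huyy, hlam, hbilap, hae⟩ := h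
  obtain rfl := hux.eq (hasSymbol_symDx_bessel a)
  have h1 := congrArg (coeff · ξ) (equation_ae_iff.1 hae)
  simp only [coeff_add, coeff_sub, coeff_smul, coeff_zero, huxx ξ, huyy ξ, hlam ξ, hbilap ξ] at h1
  rw [linSym_eq]
  push_cast at h1
  linear_combination h1

/-- Symbols of order four act on `H⁴(𝕋²)`. -/
lemma hasSymbol_mult_of_memSobolev {m : Freq → ℂ} (hm : ConjSymm m) {B : ℝ}
    (hb : ∀ ξ, ‖m ξ‖ ≤ B * weight ξ ^ 2) {u : L2} (hu : MemSobolev 4 u) :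
    HasSymbol m u (mult m u) := by
  refine hasSymbol_mult hm (((memSobolev_iff.1 hu).mul_left (B ^ 2)).of_nonneg_of_le
    (fun _ => by positivity) fun ξ => ?_)
  rw [norm_mul, mul_pow]
  calc ‖m ξ‖ ^ 2 * ‖coeff u ξ‖ ^ 2 ≤ (B * weight ξ ^ 2) ^ 2 * ‖coeff u ξ‖ ^ 2 := by
        gcongr; exact hb ξ
    _ = _ := by ring

lemma satisfiesPDE_of_memSobolev {β δ ε : ℝ} {a v : L2}
    (ha : MemSobolev 4 (bessel a))
    (hv : ∀ ξ, coeff v ξ = linSym β δ ε ξ * coeff (bessel a) ξ - coeff (transport a) ξ) :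
    SatisfiesPDE β δ ε (bessel a) v := by
  have hr : ∀ ξ : Freq, freqNorm ξ ^ 2 ≤ weight ξ := fun ξ => by unfold weight; linarith
  have hx : ∀ ξ, ‖symDx ξ ^ 2‖ ≤ weight ξ := fun ξ => by
    rw [norm_pow, norm_symDx, sq_abs]; exact sq_le_weight ξ
  have hy : ∀ ξ, ‖symDy ξ ^ 2‖ ≤ weight ξ := fun ξ => by
    have h := freqNorm_sq ξ
    have h1 : ‖symDy ξ‖ = |(ξ 1 : ℝ)| := by simp [symDy]
    rw [norm_pow, h1, sq_abs]
    nlinarith [hr ξ, sq_nonneg (ξ 0 : ℝ)]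
  have hw : ∀ ξ, weight ξ ≤ weight ξ ^ 2 := fun ξ => by
    nlinarith [one_le_weight ξ]
  have h1 := hasSymbol_mult_of_memSobolev (m := fun ξ => symDx ξ ^ 2) (B := 1)
    (fun ξ => by simp [symDx]) (fun ξ => by linarith [hx ξ, hw ξ]) ha
  have h2 := hasSymbol_mult_of_memSobolev (m := fun ξ => symDy ξ ^ 2) (B := 1)
    (fun ξ => by simp [symDy]) (fun ξ => by linarith [hy ξ, hw ξ]) ha
  have h3 := hasSymbol_mult_of_memSobolev (m := fun ξ => symLambda ξ ^ 3) (B := 1)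
    (fun ξ => by simp [symLambda, freqNorm_neg]) (fun ξ => by
      rw [norm_pow, symLambda, Complex.norm_real, Real.norm_of_nonneg (freqNorm_nonneg ξ), weight]
      nlinarith [sq_nonneg (freqNorm ξ * (freqNorm ξ - 1)), sq_nonneg (freqNorm ξ)]) ha
  have h4 := hasSymbol_mult_of_memSobolev (m := fun ξ => (symDx ξ ^ 2 + symDy ξ ^ 2) ^ 2) (B := 4)
    (fun ξ => by simp [symDx, symDy]) (fun ξ => by
      have h5 := (norm_add_le (symDx ξ ^ 2) (symDy ξ ^ 2)).trans (add_le_add (hx ξ) (hy ξ))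
      rw [norm_pow]
      have h6 := pow_le_pow_left₀ (norm_nonneg _) h5 2
      nlinarith) ha
  refine ⟨_, _, _, _, _, hasSymbol_symDx_bessel a, h1, h2, h3, h4, equation_ae_iff.2 ?_⟩
  refine ext_coeff fun ξ => ?_
  simp only [coeff_add, coeff_sub, coeff_smul, coeff_zero, h1 ξ, h2 ξ, h3 ξ, h4 ξ, hv ξ,
    linSym_eq]
  push_cast
  ring

/-! ### Mild solutions are strong solutions -/

lemma contInSobolev_bessel {a : ℝ → L2} {T : ℝ} (ha : Continuous a) :
    ContInSobolev 2 T fun t => bessel (a t) := by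
  refine fun t _ => ⟨memSobolev_bessel _, ?_⟩
  simp only [← bessel_sub, sobolevENorm_bessel]
  have h : Continuous fun r => ENNReal.ofReal ((2 * Real.pi)⁻¹ * ‖a r - a t‖) :=
    ENNReal.continuous_ofReal.comp (by fun_prop)
  have h1 := h.tendsto t
  simp only [sub_self, norm_zero, mul_zero, ENNReal.ofReal_zero] at h1
  exact h1.mono_left nhdsWithin_le_nhds

lemma measurable_sobolevENorm_sq {s : ℕ} {u : ℝ → L2} (hu : Continuous u) :
    Measurable fun t => sobolevENorm s (u t) ^ 2 := by
  simp only [sobolevENorm_sq]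
  refine Measurable.tsum fun ξ => ENNReal.measurable_ofReal.comp ?_
  exact (((continuous_coeff ξ).comp hu).norm.pow 2).const_mul _ |>.measurable

namespace IsDampedMild

variable {p : Freq → ℝ} {c C B T : ℝ} {a₀ : L2} {θ : ℝ → ℝ} {a : ℝ → L2}

/-- The parabolic gain of two derivatives in one mode. -/
lemma weight_mul_integral_le (h : IsParabolic p c C B) (ha : IsDampedMild p T a₀ θ a)
    (hT : 0 ≤ T) (ξ : Freq) :
    c * ∫ s in (0 : ℝ)..T, weight ξ ^ 4 * ‖coeff (bessel (a s)) ξ‖ ^ 2 ≤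
      ‖coeff a₀ ξ‖ ^ 2 + ∫ s in (0 : ℝ)..T, (2 * C * ‖coeff (a s) ξ‖ ^ 2 +
        c⁻¹ * ‖coeff (-(θ s • transport (a s))) ξ‖ ^ 2) := by
  have hw := weight_pos ξ
  have hc := h.c_pos
  have hcu := ha.continuous_coeff ξ
  have hcf := ha.continuous_coeff_forcing ξ
  have hca : Continuous fun s => coeff (a s) ξ := (KSTorus.continuous_coeff ξ).comp ha.continuous
  have hbal := ha.norm_sq_coeff_eq h ξ (t := T) ⟨hT, le_rfl⟩
  have h1 : ∫ s in (0 : ℝ)..T, (2 * p ξ * ‖coeff (bessel (a s)) ξ‖ ^ 2 +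
        2 * inner ℝ (coeff (bessel (a s)) ξ) (coeff (-(θ s • transport (a s))) ξ)) ≤
      ∫ s in (0 : ℝ)..T, ((weight ξ ^ 2)⁻¹ * (2 * C * ‖coeff (a s) ξ‖ ^ 2 +
        c⁻¹ * ‖coeff (-(θ s • transport (a s))) ξ‖ ^ 2) -
          (weight ξ ^ 2)⁻¹ * (c * (weight ξ ^ 4 * ‖coeff (bessel (a s)) ξ‖ ^ 2))) := by
    refine intervalIntegral.integral_mono_on hT (Continuous.intervalIntegrable (by fun_prop) _ _)
      (Continuous.intervalIntegrable (by fun_prop) _ _) fun s _ => ?_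
    rw [← weight_mul_norm_coeff_bessel (a s)]
    set y := coeff (bessel (a s)) ξ
    set f := coeff (-(θ s • transport (a s))) ξ
    have e : (weight ξ ^ 2)⁻¹ * (2 * C * (weight ξ * ‖y‖) ^ 2 + c⁻¹ * ‖f‖ ^ 2) -
        (weight ξ ^ 2)⁻¹ * (c * (weight ξ ^ 4 * ‖y‖ ^ 2)) =
        2 * C * ‖y‖ ^ 2 + (c * weight ξ ^ 2)⁻¹ * ‖f‖ ^ 2 - c * weight ξ ^ 2 * ‖y‖ ^ 2 := by
      field_simp
    rw [e]
    have h2 : inner ℝ y f ≤ ‖y‖ * ‖f‖ := real_inner_le_norm y f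
    have h3 : 2 * (‖y‖ * ‖f‖) ≤ c * weight ξ ^ 2 * ‖y‖ ^ 2 + (c * weight ξ ^ 2)⁻¹ * ‖f‖ ^ 2 := by
      set l := c * weight ξ ^ 2
      have hl : 0 < l := by positivity
      have e2 : l * ‖y‖ ^ 2 + l⁻¹ * ‖f‖ ^ 2 - 2 * (‖y‖ * ‖f‖) = (l * ‖y‖ - ‖f‖) ^ 2 / l := by
        field_simp; ring
      have : 0 ≤ (l * ‖y‖ - ‖f‖) ^ 2 / l := by positivity
      linarith
    have h4 := mul_le_mul_of_nonneg_right (h.le ξ) (sq_nonneg ‖y‖)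
    nlinarith
  have h2 : 0 ≤ ‖coeff (bessel a₀) ξ‖ ^ 2 + ∫ s in (0 : ℝ)..T,
      ((weight ξ ^ 2)⁻¹ * (2 * C * ‖coeff (a s) ξ‖ ^ 2 +
        c⁻¹ * ‖coeff (-(θ s • transport (a s))) ξ‖ ^ 2) -
          (weight ξ ^ 2)⁻¹ * (c * (weight ξ ^ 4 * ‖coeff (bessel (a s)) ξ‖ ^ 2))) := by
    have := sq_nonneg ‖coeff (bessel (a T)) ξ‖
    linarith
  rw [intervalIntegral.integral_sub (Continuous.intervalIntegrable (by fun_prop) _ _)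
    (Continuous.intervalIntegrable (by fun_prop) _ _), intervalIntegral.integral_const_mul,
    intervalIntegral.integral_const_mul, intervalIntegral.integral_const_mul] at h2
  have h3 := mul_nonneg (sq_nonneg (weight ξ)) h2
  rw [mul_add, mul_sub, mul_inv_cancel_left₀ (by positivity), mul_inv_cancel_left₀ (by positivity),
    ← mul_pow, weight_mul_norm_coeff_bessel] at h3
  linarith

/-- Mild solutions belong to `L²(0, T; H⁴(𝕋²))`. -/
lemma lintegral_sobolevENorm_lt_top (h : IsParabolic p c C B) (ha : IsDampedMild p T a₀ θ a)
    (hT : 0 ≤ T) : ∫⁻ t in Ioo 0 T, sobolevENorm 4 (bessel (a t)) ^ 2 < ∞ := by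
  have hc := h.c_pos
  have hC := h.C_nonneg
  have hac := ha.continuous
  have hfc := ha.continuous_forcing
  have hca : ∀ ξ, Continuous fun s => coeff (a s) ξ :=
    fun ξ => (KSTorus.continuous_coeff ξ).comp ha.continuous
  set Q : ℝ := c⁻¹ * (‖a₀‖ ^ 2 + ∫ s in (0 : ℝ)..T, (2 * C * ‖a s‖ ^ 2 +
        c⁻¹ * ‖-(θ s • transport (a s))‖ ^ 2)) with hQ
  have hsum : ∀ F : Finset Freq, ∑ ξ ∈ F,
      ∫ s in (0 : ℝ)..T, weight ξ ^ 4 * ‖coeff (bessel (a s)) ξ‖ ^ 2 ≤ Q := by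
    intro F
    rw [hQ, inv_mul_eq_div, le_div_iff₀' hc, Finset.mul_sum]
    refine (Finset.sum_le_sum fun ξ _ => ha.weight_mul_integral_le h hT ξ).trans ?_
    rw [Finset.sum_add_distrib, ← intervalIntegral.integral_finsetSum fun ξ _ =>
      Continuous.intervalIntegrable (by
        have := hca ξ; have := ha.continuous_coeff_forcing ξ; fun_prop) _ _]
    refine add_le_add (sum_sq_norm_coeff_le a₀ F) ?_
    refine intervalIntegral.integral_mono_on hT (Continuous.intervalIntegrable
      (continuous_finsetSum _ fun ξ _ => by
        have := hca ξ; have := ha.continuous_coeff_forcing ξ; fun_prop) _ _)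
      (Continuous.intervalIntegrable (by fun_prop) _ _) fun s _ => ?_
    rw [Finset.sum_add_distrib, ← Finset.mul_sum, ← Finset.mul_sum]
    gcongr
    · exact sum_sq_norm_coeff_le _ F
    · exact sum_sq_norm_coeff_le _ F
  simp only [sobolevENorm_sq]
  have hmeas : ∀ ξ, AEMeasurable (fun t => ENNReal.ofReal (weight ξ ^ 4 *
      ‖coeff (bessel (a t)) ξ‖ ^ 2)) (volume.restrict (Ioo 0 T)) := fun ξ =>
    (ENNReal.continuous_ofReal.comp
      (((ha.continuous_coeff ξ).norm.pow 2).const_mul _)).measurable.aemeasurable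
  rw [lintegral_tsum hmeas]
  have e : ∀ ξ, ∫⁻ t in Ioo 0 T, ENNReal.ofReal (weight ξ ^ 4 * ‖coeff (bessel (a t)) ξ‖ ^ 2) =
      ENNReal.ofReal (∫ s in (0 : ℝ)..T, weight ξ ^ 4 * ‖coeff (bessel (a s)) ξ‖ ^ 2) := fun ξ => by
    have hw := weight_pos ξ
    have hcu := ha.continuous_coeff ξ
    rw [intervalIntegral.integral_of_le hT, integral_Ioc_eq_integral_Ioo,
      ofReal_integral_eq_lintegral_ofReal]
    · exact (Continuous.integrableOn_Icc (by fun_prop)).mono_set Ioo_subset_Icc_self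
    · exact Eventually.of_forall fun s => by positivity
  simp_rw [e]
  refine lt_of_le_of_lt ?_ (ENNReal.ofReal_lt_top (r := Q))
  rw [ENNReal.tsum_eq_iSup_sum]
  refine iSup_le fun F => ?_
  rw [← ENNReal.ofReal_sum_of_nonneg]
  · exact ENNReal.ofReal_le_ofReal (hsum F)
  · intro ξ _
    have hw := weight_pos ξ
    exact intervalIntegral.integral_nonneg hT fun s _ => by positivity

lemma ae_memSobolev (h : IsParabolic p c C B) (ha : IsDampedMild p T a₀ θ a) (hT : 0 ≤ T) :
    ∀ᵐ t ∂volume.restrict (Ioo 0 T), MemSobolev 4 (bessel (a t)) := by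
  filter_upwards [ae_lt_top (measurable_sobolevENorm_sq (continuous_bessel.comp ha.continuous))
    (ha.lintegral_sobolevENorm_lt_top h hT).ne] with t ht
  simpa [MemSobolev, ENNReal.pow_lt_top_iff] using ht

end IsDampedMild

lemma enorm_sq_mult_le {p : Freq → ℝ} {c C B : ℝ} (h : IsParabolic p c C B) {u : L2}
    (hu : MemSobolev 4 u) : ‖mult (fun ξ => (p ξ : ℂ)) u‖ₑ ^ 2 ≤
      ENNReal.ofReal ((2 * Real.pi) ^ 2 * B ^ 2) * sobolevENorm 4 u ^ 2 := by
  have hs := memSobolev_iff.1 hu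
  have hsym := hasSymbol_mult_of_memSobolev (conjSymm_ofReal h.even) (B := B)
    (fun ξ => by rw [Complex.norm_real, Real.norm_eq_abs]; exact h.abs_le ξ) hu
  have h0 : ∀ ξ, 0 ≤ weight ξ ^ 4 * ‖coeff u ξ‖ ^ 2 := fun ξ => by
    have := weight_pos ξ; positivity
  rw [sobolevENorm_sq, ← ENNReal.ofReal_tsum_of_nonneg h0 hs,
    ← ENNReal.ofReal_mul (by positivity), ← ofReal_norm, ← ENNReal.ofReal_pow
      (norm_nonneg _), norm_sq_eq_tsum, mul_assoc, ← tsum_mul_left (a := B ^ 2)]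
  refine ENNReal.ofReal_le_ofReal (mul_le_mul_of_nonneg_left ?_ (by positivity))
  refine (summable_sq_norm_coeff _).tsum_le_tsum (fun ξ => ?_) (hs.mul_left _)
  rw [hsym ξ, norm_mul, mul_pow, Complex.norm_real, Real.norm_eq_abs]
  calc |p ξ| ^ 2 * ‖coeff u ξ‖ ^ 2 ≤ (B * weight ξ ^ 2) ^ 2 * ‖coeff u ξ‖ ^ 2 := by
        gcongr; exact h.abs_le ξ
    _ = _ := by ring

lemma aestronglyMeasurable_mult {p : Freq → ℝ} {c C B : ℝ} (h : IsParabolic p c C B) {u : ℝ → L2}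
    (hu : Continuous u) {μ : Measure ℝ} (hmem : ∀ᵐ t ∂μ, MemSobolev 4 (u t)) :
    AEStronglyMeasurable (fun t => mult (fun ξ => (p ξ : ℂ)) (u t)) μ := by
  -- The operator is the strong limit of its truncations to the frequencies of weight at most `n`.
  set q : ℕ → Freq → ℂ := fun n ξ => ((if weight ξ ≤ n then p ξ else 0 : ℝ) : ℂ) with hq
  have hB : 0 ≤ B := by
    have h1 := h.abs_le 0
    have h2 := weight_pos 0
    have h3 := (abs_nonneg _).trans h1
    exact nonneg_of_mul_nonneg_left h3 (by positivity)
  have hqs : ∀ n, ConjSymm (q n) := fun n => conjSymm_ofReal fun ξ => by rw [weight_neg, h.even]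
  have hqw : ∀ n ξ, ‖q n ξ‖ ≤ B * weight ξ ^ 2 := fun n ξ => by
    have hw := weight_pos ξ
    simp only [hq]
    rw [Complex.norm_real, Real.norm_eq_abs]
    split_ifs
    · exact h.abs_le ξ
    · rw [abs_zero]; positivity
  have hqb : ∀ n ξ, ‖q n ξ‖ ≤ B * n ^ 2 := fun n ξ => by
    have hw := weight_pos ξ
    by_cases hn : weight ξ ≤ n
    · refine (hqw n ξ).trans ?_
      gcongr
    · simp only [hq, if_neg hn, Complex.ofReal_zero, norm_zero]
      positivity
  refine aestronglyMeasurable_of_tendsto_ae atTop (f := fun n t => mult (q n) (u t))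
    (fun n => ?_) ?_
  · refine Continuous.aestronglyMeasurable (continuous_iff_continuousAt.2 fun t₀ => ?_)
    exact tendsto_mult (fun _ => hqs n) (hqs n) (Eventually.of_forall fun _ => hqb n) (hqb n)
      (fun _ => tendsto_const_nhds) (hu.tendsto t₀)
  · filter_upwards [hmem] with t ht
    -- `u(t)` is the image under `(1 - Δ)⁻²` of some `b`, which makes the symbols bounded.
    have hw2 : ConjSymm fun ξ => ((weight ξ ^ 2 : ℝ) : ℂ) :=
      conjSymm_ofReal fun ξ => by rw [weight_neg]
    have hb := hasSymbol_mult_of_memSobolev hw2 (B := 1) (fun ξ => by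
      rw [Complex.norm_real, Real.norm_of_nonneg (sq_nonneg _), one_mul]) ht
    set b := mult (fun ξ => ((weight ξ ^ 2 : ℝ) : ℂ)) (u t)
    have hinv : ConjSymm fun ξ => (((weight ξ ^ 2)⁻¹ : ℝ) : ℂ) :=
      conjSymm_ofReal fun ξ => by rw [weight_neg]
    have hbound : ∀ m : Freq → ℂ, (∀ ξ, ‖m ξ‖ ≤ B * weight ξ ^ 2) →
        ∀ ξ, ‖m ξ * (((weight ξ ^ 2)⁻¹ : ℝ) : ℂ)‖ ≤ B := fun m hm ξ => by
      have hw := weight_pos ξ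
      rw [norm_mul, Complex.norm_real, Real.norm_of_nonneg (by positivity), ← div_eq_mul_inv,
        div_le_iff₀ (by positivity)]
      exact hm ξ
    have key : ∀ m : Freq → ℂ, ConjSymm m → (∀ ξ, ‖m ξ‖ ≤ B * weight ξ ^ 2) →
        mult m (u t) = mult (fun ξ => m ξ * (((weight ξ ^ 2)⁻¹ : ℝ) : ℂ)) b := fun m hm hmb => by
      refine ext_coeff fun ξ => ?_
      have hw : ((weight ξ : ℝ) : ℂ) ≠ 0 := by exact_mod_cast (weight_pos ξ).ne'
      rw [hasSymbol_mult_of_memSobolev hm hmb ht ξ, coeff_mult (hm.mul hinv) (hbound m hmb), hb ξ]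
      push_cast
      field_simp
    have hpb : ∀ ξ, ‖((p ξ : ℝ) : ℂ)‖ ≤ B * weight ξ ^ 2 := fun ξ => by
      rw [Complex.norm_real, Real.norm_eq_abs]; exact h.abs_le ξ
    rw [key _ (conjSymm_ofReal h.even) hpb]
    refine Tendsto.congr (fun n => (key _ (hqs n) (hqw n)).symm) ?_
    refine tendsto_mult (fun n => (hqs n).mul hinv) ((conjSymm_ofReal h.even).mul hinv)
      (Eventually.of_forall fun n => hbound _ (hqw n)) (hbound _ hpb) (fun ξ => ?_)
      tendsto_const_nhds
    refine tendsto_const_nhds.congr' ?_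
    filter_upwards [eventually_ge_atTop ⌈weight ξ⌉₊] with n hn
    simp only [hq, if_pos (Nat.ceil_le.1 hn)]

/-- Mild solutions of the equation without truncation are strong solutions. -/
theorem isSolution_of_isDampedMild {β δ ε : ℝ} {c C B : ℝ}
    (h : IsParabolic (linSym β δ ε) c C B) {T : ℝ} (hT : 0 ≤ T) {a₀ : L2} {θ : ℝ → ℝ} {a : ℝ → L2}
    (ha : IsDampedMild (linSym β δ ε) T a₀ θ a) (hθ : ∀ t ∈ Icc 0 T, θ t = 1) :
    IsSolution β δ ε T (bessel a₀) fun t => bessel (a t) := by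
  have huc : Continuous fun t => bessel (a t) := continuous_bessel.comp ha.continuous
  have htc : Continuous fun t => transport (a t) := continuous_transport.comp ha.continuous
  have hae := ha.ae_memSobolev h hT
  have hlint := ha.lintegral_sobolevENorm_lt_top h hT
  set P : ℝ → L2 := fun t => mult (fun ξ => (linSym β δ ε ξ : ℂ)) (bessel (a t)) with hP
  have hPint : IntegrableOn P (Ioo 0 T) := by
    refine ⟨aestronglyMeasurable_mult h huc hae, ?_⟩
    have h1 : ∀ᵐ t ∂volume.restrict (Ioo 0 T), ‖P t‖ₑ ≤
        1 + ENNReal.ofReal ((2 * Real.pi) ^ 2 * B ^ 2) * sobolevENorm 4 (bessel (a t)) ^ 2 := by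
      filter_upwards [hae] with t ht
      refine le_trans ?_ (add_le_add_right (enorm_sq_mult_le h ht) 1)
      rcases le_total ‖P t‖ₑ 1 with h2 | h2
      · exact h2.trans le_self_add
      · exact (le_self_pow h2 two_ne_zero).trans le_add_self
    refine (lintegral_mono_ae h1).trans_lt ?_
    rw [lintegral_add_left measurable_const, lintegral_const_mul _
      (measurable_sobolevENorm_sq huc)]
    refine ENNReal.add_lt_top.2 ⟨?_, ENNReal.mul_lt_top ENNReal.ofReal_lt_top hlint⟩
    simp
  have hint : IntervalIntegrable (fun t => P t - transport (a t)) volume 0 T := by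
    refine IntervalIntegrable.sub ?_ (htc.intervalIntegrable 0 T)
    rw [intervalIntegrable_iff_integrableOn_Ioo_of_le hT]
    exact hPint
  have hcoeff : ∀ t, MemSobolev 4 (bessel (a t)) → ∀ ξ, coeff (P t - transport (a t)) ξ =
      linSym β δ ε ξ * coeff (bessel (a t)) ξ - coeff (transport (a t)) ξ := fun t ht ξ => by
    rw [coeff_sub, hP, hasSymbol_mult_of_memSobolev (conjSymm_ofReal h.even) (B := B)
      (fun ξ => by rw [Complex.norm_real, Real.norm_eq_abs]; exact h.abs_le ξ) ht ξ]
  have h0 : bessel (a 0) = bessel a₀ := ext_coeff fun ξ => by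
    simpa using ha.coeff_eq_add_integral h ξ 0 ⟨le_rfl, hT⟩
  refine ⟨contInSobolev_bessel ha.continuous, ⟨huc.aestronglyMeasurable, hae, hlint⟩, h0,
    fun t => P t - transport (a t), hint, fun t ht => ext_coeff fun ξ => ?_, ?_⟩
  · have hint' : IntervalIntegrable (fun t => P t - transport (a t)) volume 0 t :=
      hint.mono_set (by
        rw [uIcc_of_le ht.1, uIcc_of_le hT]; exact Icc_subset_Icc_right ht.2)
    beta_reduce
    rw [coeff_add, ha.coeff_eq_add_integral h ξ t ht, h0, ← coeffL_apply (∫ s in (0 : ℝ)..t, _),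
      ← ContinuousLinearMap.intervalIntegral_comp_comm _ hint']
    congr 1
    rw [intervalIntegral.integral_of_le ht.1, intervalIntegral.integral_of_le ht.1,
      integral_Ioc_eq_integral_Ioo, integral_Ioc_eq_integral_Ioo]
    refine integral_congr_ae ?_
    filter_upwards [ae_restrict_of_ae_restrict_of_subset (Ioo_subset_Ioo_right ht.2) hae,
      ae_restrict_mem measurableSet_Ioo] with s hs hs'
    rw [coeffL_apply, hcoeff s hs, hθ s ⟨hs'.1.le, hs'.2.le.trans ht.2⟩, one_smul, coeff_neg,
      sub_eq_add_neg]
  · filter_upwards [hae] with t ht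
    exact satisfiesPDE_of_memSobolev ht (hcoeff t ht)

/-! ### Uniqueness -/

lemma bessel_add (a b : L2) : bessel (a + b) = bessel a + bessel b :=
  ext_coeff fun ξ => by simp only [coeff_add, coeff_bessel, mul_add]

/-- A strong solution, described by the continuous function `(1 - Δ) η` with values in `L²(𝕋²)`
and by the integrated equation for the Fourier coefficients, whose integrand is continuous. -/
lemma IsSolution.exists_bessel {β δ ε T : ℝ} {η₀ : L2} {η : ℝ → L2}
    (h : IsSolution β δ ε T η₀ η) : ∃ a : ℝ → L2, ContinuousOn a (Icc 0 T) ∧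
      (∀ t ∈ Icc 0 T, bessel (a t) = η t) ∧
      ∀ ξ, ∀ t ∈ Icc 0 T, coeff (bessel (a t)) ξ = coeff η₀ ξ + ∫ s in (0 : ℝ)..t,
        (linSym β δ ε ξ * coeff (bessel (a s)) ξ - coeff (transport (a s)) ξ) := by
  obtain ⟨hcont, -, h0, ηt, hint, heq, hpde⟩ := h
  have hex : ∀ t ∈ Icc 0 T, ∃ a, bessel a = η t := fun t ht => exists_bessel_eq (hcont t ht).1
  choose! a ha using hex
  refine ⟨a, fun t ht => ?_, ha, fun ξ t ht => ?_⟩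
  · have h1 := (ENNReal.continuousAt_toReal ENNReal.zero_ne_top).tendsto.comp (hcont t ht).2
    have h2 : Tendsto (fun r => (2 * Real.pi) * ((2 * Real.pi)⁻¹ * ‖a r - a t‖)) (𝓝[Icc 0 T] t)
        (𝓝 ((2 * Real.pi) * 0)) := by
      refine Tendsto.const_mul _ ?_
      rw [← ENNReal.toReal_zero]
      refine h1.congr' ?_
      filter_upwards [self_mem_nhdsWithin] with r hr
      rw [Function.comp_apply, ← ha r hr, ← ha t ht, ← bessel_sub, sobolevENorm_bessel,
        ENNReal.toReal_ofReal (by have := Real.pi_pos; positivity)]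
    have hpi := Real.two_pi_pos.ne'
    simp only [mul_inv_cancel_left₀ hpi, mul_zero] at h2
    exact tendsto_iff_norm_sub_tendsto_zero.2 h2
  · have h0T : (0 : ℝ) ≤ T := ht.1.trans ht.2
    have hint' : IntervalIntegrable ηt volume 0 t := hint.mono_set (by
      rw [uIcc_of_le ht.1, uIcc_of_le h0T]; exact Icc_subset_Icc_right ht.2)
    rw [ha t ht, heq t ht, h0, coeff_add, ← coeffL_apply (∫ s in (0 : ℝ)..t, _),
      ← ContinuousLinearMap.intervalIntegral_comp_comm _ hint']
    congr 1
    rw [intervalIntegral.integral_of_le ht.1, intervalIntegral.integral_of_le ht.1,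
      integral_Ioc_eq_integral_Ioo, integral_Ioc_eq_integral_Ioo]
    refine integral_congr_ae ?_
    filter_upwards [ae_restrict_of_ae_restrict_of_subset (Ioo_subset_Ioo_right ht.2) hpde,
      ae_restrict_mem measurableSet_Ioo] with s hs hs'
    rw [← ha s ⟨hs'.1.le, hs'.2.le.trans ht.2⟩] at hs
    rw [coeffL_apply, coeff_of_satisfiesPDE hs]

/-- The difference of two transport terms is `½ ∂ₓ((u + u')(u - u'))`. -/
lemma coeff_transport_sub (a b : L2) (ξ : Freq) :
    coeff (transport a) ξ - coeff (transport b) ξ =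
      symDx ξ / 2 * coeff (mulL2 (bessel (a + b)) (bessel (a - b))) ξ := by
  have e : mulL2 (bessel (a + b)) (bessel (a - b)) =
      mulL2 (bessel a) (bessel a) - mulL2 (bessel b) (bessel b) := by
    ext1
    filter_upwards [coeFn_mulL2 (g := bessel (a - b)) (ae_norm_bessel_le (a + b)),
      coeFn_mulL2 (g := bessel a) (ae_norm_bessel_le a),
      coeFn_mulL2 (g := bessel b) (ae_norm_bessel_le b),
      Lp.coeFn_sub (mulL2 (bessel a) (bessel a)) (mulL2 (bessel b) (bessel b)),
      Lp.coeFn_add (bessel a) (bessel b), Lp.coeFn_sub (bessel a) (bessel b)]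
      with p h1 h2 h3 h4 h5 h6
    rw [h1, h4, Pi.sub_apply, h2, h3, bessel_add, bessel_sub, h5, h6]
    simp only [Pi.add_apply, Pi.sub_apply]
    ring
  rw [e, coeff_sub, coeff_mulL2 (ae_norm_bessel_le a), coeff_mulL2 (ae_norm_bessel_le b),
    coeff_transport, coeff_transport]
  ring

/-- Two strong solutions with the same initial datum coincide, by the energy balance of their
difference in `L²(𝕋²)`. -/
theorem IsSolution.unique {β δ ε T : ℝ} (hβ : 0 < β) (hδ : 0 ≤ δ) (hε : 0 < ε) {η₀ : L2}
    {η η' : ℝ → L2} (h : IsSolution β δ ε T η₀ η) (h' : IsSolution β δ ε T η₀ η') :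
    ∀ t ∈ Icc 0 T, η t = η' t := by
  obtain ⟨a, hac, ha, hode⟩ := h.exists_bessel
  obtain ⟨b, hbc, hb, hode'⟩ := h'.exists_bessel
  obtain ⟨c, C, B, hp⟩ : ∃ c C B, IsParabolic (linSym β δ ε) c C B :=
    ⟨_, _, _, isParabolic_linSym hβ hδ hε⟩
  have hc := hp.c_pos
  have hC := hp.C_nonneg
  have hE := embConst_nonneg
  set w : ℝ → L2 := fun s => bessel (a s - b s) with hw
  have hwc : ContinuousOn w (Icc 0 T) := continuous_bessel.comp_continuousOn (hac.sub hbc)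
  have hw' : ∀ s, w s = bessel (a s) - bessel (b s) := fun s => bessel_sub _ _
  set g : Freq → ℝ → ℂ := fun ξ s => linSym β δ ε ξ * coeff (w s) ξ -
    (coeff (transport (a s)) ξ - coeff (transport (b s)) ξ) with hg
  have hcw : ∀ ξ, ContinuousOn (fun s => coeff (w s) ξ) (Icc 0 T) := fun ξ =>
    (continuous_coeff ξ).comp_continuousOn hwc
  have hca : ∀ ξ, ContinuousOn (fun s => coeff (bessel (a s)) ξ) (Icc 0 T) := fun ξ =>
    (continuous_coeff ξ).comp_continuousOn (continuous_bessel.comp_continuousOn hac)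
  have hcb : ∀ ξ, ContinuousOn (fun s => coeff (bessel (b s)) ξ) (Icc 0 T) := fun ξ =>
    (continuous_coeff ξ).comp_continuousOn (continuous_bessel.comp_continuousOn hbc)
  have hta : ∀ ξ, ContinuousOn (fun s => coeff (transport (a s)) ξ) (Icc 0 T) := fun ξ =>
    (continuous_coeff ξ).comp_continuousOn (continuous_transport.comp_continuousOn hac)
  have htb : ∀ ξ, ContinuousOn (fun s => coeff (transport (b s)) ξ) (Icc 0 T) := fun ξ =>
    (continuous_coeff ξ).comp_continuousOn (continuous_transport.comp_continuousOn hbc)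
  have hgc : ∀ ξ, ContinuousOn (g ξ) (Icc 0 T) := fun ξ =>
    (continuousOn_const.mul (hcw ξ)).sub ((hta ξ).sub (htb ξ))
  have hii : ∀ {t : ℝ} {E : Type} [NormedAddCommGroup E] {f : ℝ → E}, t ∈ Icc 0 T →
      ContinuousOn f (Icc 0 T) → IntervalIntegrable f volume 0 t := by
    intro t E _ f ht hf
    refine (hf.mono ?_).intervalIntegrable
    rw [uIcc_of_le ht.1]
    exact Icc_subset_Icc_right ht.2
  have hwode : ∀ ξ, ∀ t ∈ Icc 0 T, coeff (w t) ξ = 0 + ∫ s in (0 : ℝ)..t, g ξ s := by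
    intro ξ t ht
    have hia := hii (f := fun s => linSym β δ ε ξ * coeff (bessel (a s)) ξ -
      coeff (transport (a s)) ξ) ht ((continuousOn_const.mul (hca ξ)).sub (hta ξ))
    have hib := hii (f := fun s => linSym β δ ε ξ * coeff (bessel (b s)) ξ -
      coeff (transport (b s)) ξ) ht ((continuousOn_const.mul (hcb ξ)).sub (htb ξ))
    rw [hw', coeff_sub, hode ξ t ht, hode' ξ t ht, add_sub_add_left_eq_sub,
      ← intervalIntegral.integral_sub hia hib, zero_add]
    congr 1
    ext s
    simp only [hg, hw', coeff_sub]
    ring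
  obtain ⟨Ma, hMa⟩ := isCompact_Icc.exists_bound_of_continuousOn hac
  obtain ⟨Mb, hMb⟩ := isCompact_Icc.exists_bound_of_continuousOn hbc
  set N : ℝ := embConst * (Ma + Mb) with hN
  set K : ℝ := 2 * C + (4 * c)⁻¹ * N ^ 2 with hK
  have hK0 : 0 ≤ K := by positivity
  -- In each mode the dissipation absorbs the derivative of `(u + u')(u - u')`.
  have hmode : ∀ ξ s, 2 * inner ℝ (coeff (w s) ξ) (g ξ s) ≤ 2 * C * ‖coeff (w s) ξ‖ ^ 2 +
      (4 * c)⁻¹ * ‖coeff (mulL2 (bessel (a s + b s)) (w s)) ξ‖ ^ 2 := by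
    intro ξ s
    simp only [hg]
    rw [coeff_transport_sub, inner_sub_right, inner_ofReal_mul_self]
    set y := coeff (w s) ξ
    set G := coeff (mulL2 (bessel (a s + b s)) (w s)) ξ
    have hwt := weight_pos ξ
    have h1 : -inner ℝ y (symDx ξ / 2 * G) ≤ ‖y‖ * (weight ξ / 2 * ‖G‖) := by
      refine (neg_le_abs _).trans ((abs_real_inner_le_norm _ _).trans ?_)
      rw [norm_mul, norm_div, norm_symDx, Complex.norm_ofNat]
      gcongr
      exact abs_le_weight ξ
    have h2 : ‖y‖ * (weight ξ * ‖G‖) ≤ c * weight ξ ^ 2 * ‖y‖ ^ 2 + (4 * c)⁻¹ * ‖G‖ ^ 2 := by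
      have e : c * weight ξ ^ 2 * ‖y‖ ^ 2 + (4 * c)⁻¹ * ‖G‖ ^ 2 - ‖y‖ * (weight ξ * ‖G‖) =
          (2 * c * weight ξ * ‖y‖ - ‖G‖) ^ 2 / (4 * c) := by
        field_simp; ring
      have : 0 ≤ (2 * c * weight ξ * ‖y‖ - ‖G‖) ^ 2 / (4 * c) := by positivity
      linarith
    have h3 := mul_le_mul_of_nonneg_right (hp.le ξ) (sq_nonneg ‖y‖)
    have h4 : 0 ≤ c * weight ξ ^ 2 * ‖y‖ ^ 2 := by positivity
    nlinarith
  have hG : ∀ s ∈ Icc 0 T, ‖mulL2 (bessel (a s + b s)) (w s)‖ ≤ N * ‖w s‖ := fun s hs => by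
    refine (norm_mulL2_le (ae_norm_bessel_le _)).trans ?_
    rw [hN]
    gcongr
    exact (norm_add_le _ _).trans (add_le_add (hMa s hs) (hMb s hs))
  have hsum : ∀ t ∈ Icc 0 T, ∀ F : Finset Freq, ∑ ξ ∈ F, ‖coeff (w t) ξ‖ ^ 2 ≤
      K * ∫ s in (0 : ℝ)..t, ‖w s‖ ^ 2 := by
    intro t ht F
    have hc1 : ∀ ξ, ContinuousOn (fun s => 2 * inner ℝ (coeff (w s) ξ) (g ξ s)) (Icc 0 T) :=
      fun ξ => continuousOn_const.mul ((hcw ξ).inner (hgc ξ))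
    have e : ∑ ξ ∈ F, ‖coeff (w t) ξ‖ ^ 2 = ∫ s in (0 : ℝ)..t,
        ∑ ξ ∈ F, 2 * inner ℝ (coeff (w s) ξ) (g ξ s) := by
      rw [intervalIntegral.integral_finsetSum fun ξ _ => hii ht (hc1 ξ)]
      refine Finset.sum_congr rfl fun ξ _ => ?_
      rw [norm_sq_eq_add_integral (hgc ξ) (hwode ξ) t ht]
      simp
    rw [e, ← intervalIntegral.integral_const_mul]
    refine intervalIntegral.integral_mono_on ht.1
      (hii ht (continuousOn_finsetSum _ fun ξ _ => hc1 ξ))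
      (hii ht (continuousOn_const.mul (hwc.norm.pow 2))) fun s hs => ?_
    refine (Finset.sum_le_sum fun ξ _ => hmode ξ s).trans ?_
    rw [Finset.sum_add_distrib, ← Finset.mul_sum, ← Finset.mul_sum, hK, add_mul,
      mul_assoc _ (N ^ 2), ← mul_pow]
    gcongr
    · exact sum_sq_norm_coeff_le _ F
    · exact (sum_sq_norm_coeff_le _ F).trans
        (pow_le_pow_left₀ (norm_nonneg _) (hG s ⟨hs.1, hs.2.trans ht.2⟩) 2)
  have hle : ∀ t ∈ Icc 0 T, ‖w t‖ ^ 2 ≤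
      0 + (2 * Real.pi) ^ 2 * K * ∫ s in (0 : ℝ)..t, ‖w s‖ ^ 2 := fun t ht => by
    rw [norm_sq_eq_tsum, zero_add, mul_assoc]
    exact mul_le_mul_of_nonneg_left
      ((summable_sq_norm_coeff (w t)).tsum_le_of_sum_le (hsum t ht)) (by positivity)
  intro t ht
  have h1 := le_mul_exp_of_le_add_integral (hwc.norm.pow 2) (by positivity) hle t ht
  have h2 : w t = 0 := by
    rw [zero_mul] at h1
    have := le_antisymm h1 (sq_nonneg _)
    simpa using this
  rw [← ha t ht, ← hb t ht, ← sub_eq_zero, ← hw', h2]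

end KSTorus
end

theorem mainTheorem1 (β δ ε : ℝ) (hβ : 0 < β) (hδ : 0 ≤ δ) (hε : 0 < ε)
    (η₀ : KSTorus.L2) (hη₀ : KSTorus.MemSobolev 2 η₀) (T : ℝ) (hT : 0 < T) :
    ∃ η : ℝ → KSTorus.L2, KSTorus.IsSolution β δ ε T η₀ η ∧
      ∀ η' : ℝ → KSTorus.L2, KSTorus.IsSolution β δ ε T η₀ η' →
        ∀ t ∈ Set.Icc 0 T, η' t = η t := by
  obtain ⟨a₀, rfl⟩ := KSTorus.exists_bessel_eq hη₀
  have hp := KSTorus.isParabolic_linSym hβ hδ hε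
  obtain ⟨θ, a, ha, hθ⟩ := KSTorus.exists_isDampedMild_eq_one hp hT.le a₀
  have hsol := KSTorus.isSolution_of_isDampedMild hp hT.le ha hθ
  exact ⟨_, hsol, fun η' h' => h'.unique hβ hδ hε hsol⟩
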